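/- **Network.** A network consists of a finite set $\mathcal M$ of subsystems with a symmetric neighbour relation ($\mathcal N_i\subseteq\mathcal M$, $i\in\mathcal N_i$) and dynamics $$x_i^+=A_ix_i+B_iu_i+\sum_{k=1}^{p}F_{i,k}\sum_{j\in\mathcal N_i\setminus i}l_{ij,k}\,(C_{j,k}x_j-C_{i,k}x_i)=A_{N_i}x_{N_i}+B_iu_i ,$$ with $x_i\in\mathbb R^{n_i}$, $n_i\ge1$, $u_i\in\mathbb R^{m_i}$, where $x_{N_i}$ stacks the states of the subsystems in $\mathcal N_i$, and constraints $x_i\in\mathcal X_i=\{G_ix_i\le g_i\}$, $u_i\in\mathcal U_i=\{H_iu_i\le h_i\}$. Let $x=[x_1;\dots;x_M]$, $u=[u_1;\dots;u_M]$, and let $U_i,V_i,W_i$ be the $0$-$1$ matrices with $x_i=U_ix$, $u_i=V_iu$, $x_{N_i}=W_ix$. Each subsystem has positive definite cost matrices $Q_i,R_i,P_i,S_i$, a terminal gain $K_i$ and $\lambda_i\in(0,1)$. Put $\bar A_i=A_{N_i}+B_iK_iU_iW_i^\top$ and $P_{ij}=W_iU_j^\top P_jU_jW_i^\top$. The scalars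 $n_{ij}$ satisfy $n_{ij}>0$ if $i\in\mathcal N_j$, $n_{ij}=0$ otherwise, and $\sum_{i}n_{ij}\le1$ for all $j$. The local matrix inequality of subsystem $i$ is $$\sum_{j\in\mathcal N_i}n_{ij}P_{ij}-W_iU_i^\top(Q_i+K_i^\top R_iK_i)U_iW_i^\top-\bar A_i^\top P_i\bar A_i\succeq0.\tag{1}$$ **Controller.** For a matrix $X$ let $[X]_k$ be the $k$-th diagonal entry, $\{X\}_k$ the sum of the absolute values in row $k$, and $|X|$ the entrywise absolute value; let $\alpha_{N_i}$ be the block diagonal matrix with blocks $\alpha_jI_{n_j}$, $j\in\mathcal N_i$. Fix a horizon $T\ge1$ and a target $(x_r,u_r)$. At the measured state $x_m$ the controller minimizes $$\sum_i\Big(\sum_{t<T}\big(\|x_i(t)-x_{e_i}\|_{Q_i}^2+\|u_i(t)-u_{e_i}\|_{R_i}^2\big)+\|x_i(T)-x_{e_i}\|_{P_i}^2+\|x_{e_i}-x_{r_i}\|_{S_i}^2\Big)$$ (where $\|v\|_X^2=v^\top Xv$) over $x_i(t),u_i(t),x_{e_i},u_{e_i},\alpha_i\ge0,c_i,d_i,b_i,\lambda_{ij}\ge0$,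 subject to $x(0)=x_m$; the dynamics; $x_i(t)\in\mathcal X_i$ for $t\le T$ and $u_i(t)\in\mathcal U_i$ for $t<T$; the equilibrium constraints $x_{e_i}=A_{N_i}x_{e_{N_i}}+B_iu_{e_i}\in\lambda_i\mathcal X_i$, $u_{e_i}=K_ix_{e_i}+d_i\in\lambda_i\mathcal U_i$; a terminal constraint $x_i(T)\in\mathcal X_{f_i}$; the invariance constraints $$2\alpha_i[P_i^{-1}]_k\ge\alpha_i\{P_i^{-1}\}_k+\sum_l(|\bar A_i|\alpha_{N_i})_{kl}+b_{i_k},\qquad -b_i\le\bar A_ic_{N_i}+B_id_i-c_i\le b_i,$$ $$2\sum_{j\in\mathcal N_i}\lambda_{ij}[P_{ij}]_k\ge\sum_{j\in\mathcal N_i}\lambda_{ij}\{P_{ij}\}_k+\sum_l(|\bar A_i|\alpha_{N_i})^\top_{kl},\qquad \alpha_i-\sum_{j\in\mathcal N_i}\lambda_{ij}\ge\sum_lb_{i_l};\tag{2}$$ and, for all rows, $G_i^kc_i+\|G_i^kP_i^{-1/2}\|_2\alpha_i\le g_i^k$ and $H_i^lK_ic_i+H_i^ld_i+\|H_i^lK_iP_i^{-1/2}\|_2\alpha_i\le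 h_i^l$. The terminal constraint is either (a) the ellipsoid $(x_i(T)-c_i)^\top P_i(x_i(T)-c_i)\le\alpha_i^2$, or (b) its polyhedral inner approximation: for some $\bar b_i$, $2\alpha_i[P_i^{-1}]_j\ge\bar b_{i_j}+\alpha_i\{P_i^{-1}\}_j$ for all $j$, $\alpha_i\ge\sum_j\bar b_{i_j}$ and $-\bar b_i\le x_i(T)-c_i\le\bar b_i$. The first input $u(0)$ of any minimizer is applied, and the problem is solved again at the next state. **Plug-and-play.** Networks $0,1,\dots,k$ arise from one another by requests. For a request let $\mathcal J$ be the set of joining and $\mathcal L$ the set of leaving subsystems, and $\mathcal Z$ the set of the remaining subsystems that have a (new) neighbour in $\mathcal J$ or had a neighbour in $\mathcal L$. Subsystems outside $\mathcal J\cup\mathcal Z$ keep their dynamics, neighbours, $K_i$ and $P_i$; those that moreover have no neighbour in $\mathcal J\cup\mathcal Z$ keep $Q_i$, $R_i$ and their $n_{ij}$. (A rejected request changes nothing.) **Assumption 1** (on network $0$). There are $\epsilon_i>0$ and diagonal positive definite $\Gamma_i\in\mathbb R^{n_i\times n_i}$, $D_i\in\mathbb R^{p\times p}$ such that for every $i$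 and all $\xi\in\mathbb R^{n_i}$, $v\in\mathbb R^p$, with $\xi^+=(A_i+B_iK_i)\xi+\sum_kF_{i,k}v_k$ and $C_i$ the matrix with rows $C_{i,k}$, $$(\xi^+)^\top P_i\xi^+-\xi^\top P_i\xi\le v^\top(C_i\xi+D_iv)-\xi^\top\Gamma_i\xi;$$ moreover $[\Gamma_i^{-1}]_j\le1/(\{C_{L_i}\}_j+\epsilon_i)$ for $j\le n_i$, $[D_i]_j\le1/\{L_{C_i}\}_j$ for all $j\le p$ with $\{L_{C_i}\}_j>0$, and (1) holds. Here $C_{L_i}$ and $L_{C_i}$ are the $i$-th block rows of $C^\top L^\top$ and $LC$, with $C=\operatorname{diag}(C_1,\dots,C_M)$, $L=\sum_kL_k\otimes e_ke_k^\top$ and $L_k$ the Laplacian with weights $l_{ij,k}$. **Theorem.** Let Assumption 1 hold for network $0$, and suppose that after each of the $k$ requests (1) holds, with the positive definite $Q_i,R_i$ that are then used as stage costs, for every subsystem in $\mathcal J$, in $\mathcal Z$ and for all their neighbours. Suppose that in the $k$-th network $0$ is an interior point of every $\mathcal X_i$ and $\mathcal U_i$, that (2) can be satisfied with all $\alpha_i>0$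 (for some $c,d,b$ and $\lambda_{ij}\ge0$), and that the target is an admissible equilibrium: $x_{r_i}=A_{N_i}x_{r_{N_i}}+B_iu_{r_i}\in\lambda_i\mathcal X_i$ and $u_{r_i}\in\lambda_i\mathcal U_i$. Then the $k$-th network under the controller is asymptotically stable to $x_r$ in the presence of constraints: there is a neighbourhood $E$ of $x_r$ on which the optimization problem is feasible (and, if all $\mathcal X_i,\mathcal U_i$ are bounded, has a minimizer) and which the closed loop does not leave; closed-loop trajectories that start in $E$ satisfy the constraints at all times and converge to $x_r$; and $x_r$ is Lyapunov stable for them. With terminal constraint (a), $E$ can be taken to be the set of all states at which the optimization problem is feasible; with terminal constraint (b), such a neighbourhood $E$ exists. -/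

import Mathlib

open Filter Topology
open scoped Matrix Pointwise

/-- The sum of the absolute values of the entries in row `j` of `X`, written `{X}_j`. -/
def rowAbs {a b : Type*} [Fintype b] (X : Matrix a b ℝ) (j : a) : ℝ := ∑ l, |X j l|

/-- The weighted squared norm `vᵀ X v`. -/
def quad {a : Type*} [Fintype a] (X : Matrix a a ℝ) (v : a → ℝ) : ℝ := v ⬝ᵥ (X *ᵥ v)

/-- A network of linear subsystems with Laplacian interconnections, polytopic constraints and
the data of a tracking model predictive controller.

`ι` is the type of labels of all subsystems that may ever take part, `M` is the set of those that
are in the network. Subsystem `i` has state dimension `n i`, input dimension `m i`, `q i` state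
constraints and `r i` input constraints; all subsystems have `p` outputs. -/
structure Network (ι : Type*) [DecidableEq ι] (n m q r : ι → ℕ) (p : ℕ) where
  /-- the subsystems of the network -/
  M : Finset ι
  /-- the neighbours of a subsystem, itself included -/
  N : ι → Finset ι
  N_subset : ∀ i ∈ M, N i ⊆ M
  self_mem_N : ∀ i ∈ M, i ∈ N i
  N_symm : ∀ i ∈ M, ∀ j ∈ M, j ∈ N i → i ∈ N j
  A : ∀ i, Matrix (Fin (n i)) (Fin (n i)) ℝ
  B : ∀ i, Matrix (Fin (n i)) (Fin (m i)) ℝ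
  /-- `F i k` is the vector through which the `k`-th interconnection acts on subsystem `i` -/
  F : ∀ i, Fin p → Fin (n i) → ℝ
  /-- `C i k` is the row vector of the `k`-th output of subsystem `i` -/
  C : ∀ i, Fin p → Fin (n i) → ℝ
  /-- `l i j k` is the weight with which the `k`-th output of `j` acts on `i` -/
  l : ι → ι → Fin p → ℝ
  G : ∀ i, Matrix (Fin (q i)) (Fin (n i)) ℝ
  g : ∀ i, Fin (q i) → ℝ
  H : ∀ i, Matrix (Fin (r i)) (Fin (m i)) ℝ
  h : ∀ i, Fin (r i) → ℝ
  /-- the feedback gain of the terminal controller `K i x + d i` -/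
  K : ∀ i, Matrix (Fin (m i)) (Fin (n i)) ℝ
  /-- terminal cost matrices -/
  P : ∀ i, Matrix (Fin (n i)) (Fin (n i)) ℝ
  /-- stage cost matrices of the states -/
  Q : ∀ i, Matrix (Fin (n i)) (Fin (n i)) ℝ
  /-- stage cost matrices of the inputs -/
  R : ∀ i, Matrix (Fin (m i)) (Fin (m i)) ℝ
  /-- cost matrices of the distance between artificial equilibrium and target -/
  S : ∀ i, Matrix (Fin (n i)) (Fin (n i)) ℝ
  P_posDef : ∀ i ∈ M, (P i).PosDef
  Q_posDef : ∀ i ∈ M, (Q i).PosDef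
  R_posDef : ∀ i ∈ M, (R i).PosDef
  S_posDef : ∀ i ∈ M, (S i).PosDef
  /-- the factor `λ_i` by which the constraints on the artificial equilibrium are tightened -/
  lam : ι → ℝ
  lam_mem : ∀ i ∈ M, lam i ∈ Set.Ioo (0 : ℝ) 1
  /-- the scalars `n_ij` -/
  w : ι → ι → ℝ
  w_pos : ∀ i ∈ M, ∀ j ∈ M, i ∈ N j → 0 < w i j
  w_zero : ∀ i ∈ M, ∀ j ∈ M, i ∉ N j → w i j = 0
  /-- The total weight that is put on `P_j` in the local inequalities is at most one. -/
  w_sum : ∀ j ∈ M, ∑ i ∈ M, w i j ≤ 1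

namespace Network

variable {ι : Type*} [DecidableEq ι] {n m q r : ι → ℕ} {p : ℕ} (ν : Network ι n m q r p)

/-- Index set of the stacked state `x = [x_1; …; x_M]`. -/
abbrev StateIdx : Type _ := Σ j : ν.M, Fin (n j)

/-- Index set of the stacked input `u = [u_1; …; u_M]`. -/
abbrev InputIdx : Type _ := Σ j : ν.M, Fin (m j)

/-- Index set of the stacked state `x_{N_i}` of the neighbours of `i`. -/
abbrev NbrIdx (i : ι) : Type _ := Σ j : ν.N i, Fin (n j)

/-- The 0-1 matrix with `x_i = U_i x`. -/
def U (i : ι) : Matrix (Fin (n i)) ν.StateIdx ℝ := fun a s =>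
  if (⟨i, a⟩ : Σ j, Fin (n j)) = ⟨s.1, s.2⟩ then 1 else 0

/-- The 0-1 matrix with `u_i = V_i u`. -/
def V (i : ι) : Matrix (Fin (m i)) ν.InputIdx ℝ := fun a s =>
  if (⟨i, a⟩ : Σ j, Fin (m j)) = ⟨s.1, s.2⟩ then 1 else 0

/-- The 0-1 matrix with `x_{N_i} = W_i x`. -/
def W (i : ι) : Matrix (ν.NbrIdx i) ν.StateIdx ℝ := fun a s =>
  if (⟨a.1, a.2⟩ : Σ j, Fin (n j)) = ⟨s.1, s.2⟩ then 1 else 0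

/-- The matrix `U_j W_iᵀ`, which selects `x_j` from `x_{N_i}` when `j` is a neighbour of `i`. -/
def sel (i j : ι) : Matrix (Fin (n j)) (ν.NbrIdx i) ℝ := ν.U j * (ν.W i)ᵀ

/-- The matrix `A_{N_i}`, for which `A_{N_i} x_{N_i}` equals
`A_i x_i + ∑_k F_{i,k} ∑_{j ∈ N_i \ i} l_{ij,k} (C_{j,k} x_j - C_{i,k} x_i)`. -/
def AN (i : ι) : Matrix (Fin (n i)) (ν.NbrIdx i) ℝ :=
  ν.A i * ν.sel i i +
    ∑ k : Fin p, ∑ j ∈ (ν.N i).erase i, ν.l i j k •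
      Matrix.vecMulVec (ν.F i k) (ν.C j k ᵥ* ν.sel i j - ν.C i k ᵥ* ν.sel i i)

/-- The terminal closed-loop matrix `A_{N_i} + B_i K_i U_i W_iᵀ`. -/
def Acl (i : ι) : Matrix (Fin (n i)) (ν.NbrIdx i) ℝ :=
  ν.AN i + ν.B i * ν.K i * ν.U i * (ν.W i)ᵀ

/-- The state constraint set of subsystem `i`. -/
def X (i : ι) : Set (Fin (n i) → ℝ) := {x | ν.G i *ᵥ x ≤ ν.g i}

/-- The input constraint set of subsystem `i`. -/
def Uset (i : ι) : Set (Fin (m i) → ℝ) := {u | ν.H i *ᵥ u ≤ ν.h i}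

/-- The stacked states `x`, `y` and the stacked input `u` satisfy `y = x⁺`, that is,
`y_i = A_{N_i} x_{N_i} + B_i u_i` for every subsystem. -/
def Next (x : ν.StateIdx → ℝ) (u : ν.InputIdx → ℝ) (y : ν.StateIdx → ℝ) : Prop :=
  ∀ i ∈ ν.M, ν.U i *ᵥ y = ν.AN i *ᵥ (ν.W i *ᵥ x) + ν.B i *ᵥ (ν.V i *ᵥ u)

/-! ### The local matrix inequality and the conditions on the initial network -/

/-- The matrix `W_i U_jᵀ P_j U_j W_iᵀ`. -/
def Pij (i j : ι) : Matrix (ν.NbrIdx i) (ν.NbrIdx i) ℝ :=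
  ν.W i * (ν.U j)ᵀ * ν.P j * ν.U j * (ν.W i)ᵀ

/-- The local matrix inequality of subsystem `i`. -/
def LocalLMI (i : ι) : Prop :=
  ((∑ j ∈ ν.N i, ν.w i j • ν.Pij i j)
    - ν.W i * (ν.U i)ᵀ * (ν.Q i + (ν.K i)ᵀ * ν.R i * ν.K i) * ν.U i * (ν.W i)ᵀ
    - (ν.Acl i)ᵀ * ν.P i * ν.Acl i).PosSemidef

/-- The Laplacian of the `k`-th interconnection graph. -/
def lap (k : Fin p) : Matrix ν.M ν.M ℝ := fun i j =>
  if i = j then ∑ j' ∈ (ν.N i).erase i, ν.l i j' k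
  else if (j : ι) ∈ ν.N i then - ν.l i j k else 0

/-- `L = ∑_k L_k ⊗ e_k e_kᵀ`. -/
def bigL : Matrix (ν.M × Fin p) (ν.M × Fin p) ℝ :=
  ∑ k : Fin p, Matrix.kroneckerMap (· * ·) (ν.lap k) (Matrix.single k k (1 : ℝ))

/-- `C = diag(C_1, …, C_M)`. -/
def bigC : Matrix (ν.M × Fin p) ν.StateIdx ℝ := fun a s =>
  if a.1 = s.1 then ν.C s.1 a.2 s.2 else 0

/-- Under `u_i = K_i x_i + d_i` and in coordinates that are shifted to an equilibrium, subsystem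
`i` is strictly passive from `Δv_i` to the virtual output `Δz_i = C_i Δx_i + D_i Δv_i`, with
storage function `Δx_iᵀ P_i Δx_i` and dissipation function `Δx_iᵀ Γ_i Δx_i`. -/
def StrictlyPassive (i : ι) (Γ : Matrix (Fin (n i)) (Fin (n i)) ℝ)
    (D : Matrix (Fin p) (Fin p) ℝ) : Prop :=
  ∀ (x : Fin (n i) → ℝ) (v : Fin p → ℝ),
    quad (ν.P i) ((ν.A i + ν.B i * ν.K i) *ᵥ x + ∑ k, v k • ν.F i k) - quad (ν.P i) x
      ≤ ∑ k, v k * (ν.C i k ⬝ᵥ x + (D *ᵥ v) k) - quad Γ x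

/-- The standing assumption on the network before any plug-and-play request: every subsystem is
strictly passive, the dissipation and feedthrough matrices are bounded through the absolute row
sums of `C_L = Cᵀ Lᵀ` and `L_C = L C`, and the local matrix inequality holds. -/
def InitialAssumption : Prop :=
  ∃ (Γ : ∀ i, Matrix (Fin (n i)) (Fin (n i)) ℝ) (D : ι → Matrix (Fin p) (Fin p) ℝ) (ε : ι → ℝ),
    ∀ i : ν.M, 0 < ε i ∧ (Γ i).IsDiag ∧ (Γ i).PosDef ∧ (D i).IsDiag ∧ (D i).PosDef ∧
      ν.StrictlyPassive i (Γ i) (D i) ∧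
      (∀ j : Fin (n i), (Γ i)⁻¹ j j ≤ 1 / (rowAbs (ν.bigCᵀ * ν.bigLᵀ) ⟨i, j⟩ + ε i)) ∧
      (∀ j : Fin p, 0 < rowAbs (ν.bigL * ν.bigC) (i, j) →
        D i j j ≤ 1 / rowAbs (ν.bigL * ν.bigC) (i, j)) ∧
      ν.LocalLMI i

/-! ### The model predictive controller -/

/-- A terminal constraint: it assigns a set to a terminal cost matrix, a centre and a size. -/
abbrev TerminalConstraint : Type :=
  ∀ d : ℕ, Matrix (Fin d) (Fin d) ℝ → (Fin d → ℝ) → ℝ → Set (Fin d → ℝ)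

/-- The ellipsoid `(x - c)ᵀ P (x - c) ≤ α²`. -/
def ellipsoid : TerminalConstraint := fun _ P c α => {x | quad P (x - c) ≤ α ^ 2}

/-- The polyhedral inner approximation of the ellipsoid that is obtained from the Schur
complement and diagonal dominance. -/
def dominated : TerminalConstraint := fun _ P c α =>
  {x | ∃ bb : Fin _ → ℝ, (∀ j, bb j + α * rowAbs P⁻¹ j ≤ 2 * α * P⁻¹ j j) ∧ ∑ j, bb j ≤ α ∧
    ∀ j, -bb j ≤ x j - c j ∧ x j - c j ≤ bb j}

/-- The decision variables of the optimal control problem. Only the values `x t` with `t ≤ T`,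
`u t` with `t < T`, `α i` with `i ∈ M` and `mu i j` with `i ∈ M`, `j ∈ N i` are constrained or
enter the cost. -/
structure Plan where
  /-- predicted states -/
  x : ℕ → ν.StateIdx → ℝ
  /-- predicted inputs -/
  u : ℕ → ν.InputIdx → ℝ
  /-- artificial equilibrium -/
  xe : ν.StateIdx → ℝ
  /-- input of the artificial equilibrium -/
  ue : ν.InputIdx → ℝ
  /-- sizes of the terminal sets -/
  α : ι → ℝ
  /-- centres of the terminal sets -/
  c : ν.StateIdx → ℝ
  /-- offsets of the terminal controllers -/
  d : ν.InputIdx → ℝ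
  /-- slack vectors -/
  b : ν.StateIdx → ℝ
  /-- multipliers -/
  mu : ι → ι → ℝ

/-- The block diagonal matrix `α_{N_i}` with the blocks `α_j I`, `j ∈ N_i`. -/
def αN (i : ι) (α : ι → ℝ) : Matrix (ν.NbrIdx i) (ν.NbrIdx i) ℝ :=
  Matrix.diagonal fun s => α s.1

/-- The constraints through which the terminal set of subsystem `i` is made invariant: diagonal
dominance of the matrix that the S-procedure yields, with the nonnegative multipliers `mu`. -/
def InvarianceConstraint (i : ι) (α : ι → ℝ) (c : ν.StateIdx → ℝ) (d : ν.InputIdx → ℝ)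
    (b : ν.StateIdx → ℝ) (mu : ι → ι → ℝ) : Prop :=
  (∀ k, α i * rowAbs (ν.P i)⁻¹ k + ∑ l, ((ν.Acl i).map abs * ν.αN i α) k l + (ν.U i *ᵥ b) k
      ≤ 2 * α i * (ν.P i)⁻¹ k k) ∧
  (∀ k, |(ν.Acl i *ᵥ (ν.W i *ᵥ c) + ν.B i *ᵥ (ν.V i *ᵥ d) - ν.U i *ᵥ c) k| ≤ (ν.U i *ᵥ b) k) ∧
  (∀ k, ∑ j ∈ ν.N i, mu i j * rowAbs (ν.Pij i j) k
        + ∑ l, ((ν.Acl i).map abs * ν.αN i α)ᵀ k l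
      ≤ 2 * ∑ j ∈ ν.N i, mu i j * ν.Pij i j k k) ∧
  ∑ k, (ν.U i *ᵥ b) k ≤ α i - ∑ j ∈ ν.N i, mu i j ∧
  ∀ j ∈ ν.N i, 0 ≤ mu i j

/-- Feasibility of a plan for horizon `T` and measured state `x₀`, with terminal constraint `Xf`.
In the last two constraints, `√(aᵀ P⁻¹ a)` is the Euclidean norm of `aᵀ P^{-1/2}`. -/
structure Feasible (Xf : TerminalConstraint) (T : ℕ) (x₀ : ν.StateIdx → ℝ) (z : ν.Plan) :
    Prop where
  init : z.x 0 = x₀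
  dyn : ∀ t < T, ν.Next (z.x t) (z.u t) (z.x (t + 1))
  state : ∀ t ≤ T, ∀ i ∈ ν.M, ν.U i *ᵥ z.x t ∈ ν.X i
  input : ∀ t < T, ∀ i ∈ ν.M, ν.V i *ᵥ z.u t ∈ ν.Uset i
  eq_dyn : ν.Next z.xe z.ue z.xe
  eq_state : ∀ i ∈ ν.M, ν.U i *ᵥ z.xe ∈ ν.lam i • ν.X i
  eq_ctrl : ∀ i ∈ ν.M, ν.V i *ᵥ z.ue = ν.K i *ᵥ (ν.U i *ᵥ z.xe) + ν.V i *ᵥ z.d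
  eq_input : ∀ i ∈ ν.M, ν.V i *ᵥ z.ue ∈ ν.lam i • ν.Uset i
  size : ∀ i ∈ ν.M, 0 ≤ z.α i
  terminal : ∀ i ∈ ν.M, ν.U i *ᵥ z.x T ∈ Xf (n i) (ν.P i) (ν.U i *ᵥ z.c) (z.α i)
  invariance : ∀ i ∈ ν.M, ν.InvarianceConstraint i z.α z.c z.d z.b z.mu
  term_state : ∀ i ∈ ν.M, ∀ k, ν.G i k ⬝ᵥ (ν.U i *ᵥ z.c)
      + √(ν.G i k ⬝ᵥ ((ν.P i)⁻¹ *ᵥ ν.G i k)) * z.α i ≤ ν.g i k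
  term_input : ∀ i ∈ ν.M, ∀ l, ν.H i l ⬝ᵥ (ν.K i *ᵥ (ν.U i *ᵥ z.c)) + ν.H i l ⬝ᵥ (ν.V i *ᵥ z.d)
      + √((ν.H i l ᵥ* ν.K i) ⬝ᵥ ((ν.P i)⁻¹ *ᵥ (ν.H i l ᵥ* ν.K i))) * z.α i ≤ ν.h i l

/-- The cost `∑_i J_i` for the target `xr`. -/
def cost (T : ℕ) (xr : ν.StateIdx → ℝ) (z : ν.Plan) : ℝ :=
  ∑ i ∈ ν.M, (∑ t ∈ Finset.range T,
      (quad (ν.Q i) (ν.U i *ᵥ z.x t - ν.U i *ᵥ z.xe)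
        + quad (ν.R i) (ν.V i *ᵥ z.u t - ν.V i *ᵥ z.ue))
    + quad (ν.P i) (ν.U i *ᵥ z.x T - ν.U i *ᵥ z.xe)
    + quad (ν.S i) (ν.U i *ᵥ z.xe - ν.U i *ᵥ xr))

/-- `z` solves the optimal control problem at the measured state `x₀`. -/
def Optimal (Xf : TerminalConstraint) (T : ℕ) (xr x₀ : ν.StateIdx → ℝ) (z : ν.Plan) : Prop :=
  ν.Feasible Xf T x₀ z ∧ ∀ z', ν.Feasible Xf T x₀ z' → ν.cost T xr z ≤ ν.cost T xr z'

/-- The states at which the optimal control problem is feasible. -/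
def feasibleStates (Xf : TerminalConstraint) (T : ℕ) : Set (ν.StateIdx → ℝ) :=
  {x₀ | ∃ z, ν.Feasible Xf T x₀ z}

/-- One step of the closed loop: at `x` the first input `u` of an optimal plan is applied, and the
network moves to `y`. (Optimal plans need not be unique; any of them may be used.) -/
def MPCStep (Xf : TerminalConstraint) (T : ℕ) (xr x : ν.StateIdx → ℝ) (u : ν.InputIdx → ℝ)
    (y : ν.StateIdx → ℝ) : Prop :=
  (∃ z, ν.Optimal Xf T xr x z ∧ z.u 0 = u) ∧ ν.Next x u y

/-- A state and input trajectory of the closed loop. -/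
def ClosedLoop (Xf : TerminalConstraint) (T : ℕ) (xr : ν.StateIdx → ℝ)
    (x : ℕ → ν.StateIdx → ℝ) (u : ℕ → ν.InputIdx → ℝ) : Prop :=
  ∀ t, ν.MPCStep Xf T xr (x t) (u t) (x (t + 1))

/-- In the presence of the constraints, the closed loop is asymptotically stable to the target
`xr` with region of attraction `E`. -/
structure AsymptoticallyStable (Xf : TerminalConstraint) (T : ℕ) (xr : ν.StateIdx → ℝ)
    (E : Set (ν.StateIdx → ℝ)) : Prop where
  /-- the region of attraction is a neighbourhood of the target -/
  nhds : E ∈ 𝓝 xr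
  /-- the optimal control problem is feasible on the region of attraction -/
  feasible : E ⊆ ν.feasibleStates Xf T
  /-- for bounded constraint sets its minimum is attained there -/
  solvable : (∀ i ∈ ν.M, Bornology.IsBounded (ν.X i) ∧ Bornology.IsBounded (ν.Uset i)) →
    ∀ x ∈ E, ∃ z, ν.Optimal Xf T xr x z
  /-- the closed loop does not leave the region of attraction -/
  invariant : ∀ x ∈ E, ∀ u y, ν.MPCStep Xf T xr x u y → y ∈ E
  /-- the constraints are satisfied along the closed loop -/
  constraints : ∀ x u, ν.ClosedLoop Xf T xr x u → x 0 ∈ E →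
    ∀ t, ∀ i ∈ ν.M, ν.U i *ᵥ x t ∈ ν.X i ∧ ν.V i *ᵥ u t ∈ ν.Uset i
  /-- Lyapunov stability of the target -/
  stable : ∀ ε > 0, ∃ δ > 0, ∀ x u, ν.ClosedLoop Xf T xr x u → x 0 ∈ E →
    dist (x 0) xr < δ → ∀ t, dist (x t) xr < ε
  /-- attractivity of the target -/
  attractive : ∀ x u, ν.ClosedLoop Xf T xr x u → x 0 ∈ E → Tendsto x atTop (𝓝 xr)

/-- The target `(xr, ur)` satisfies the constraints on artificial equilibria: it is an
equilibrium and lies in the tightened constraint sets. -/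
def AdmissibleTarget (xr : ν.StateIdx → ℝ) (ur : ν.InputIdx → ℝ) : Prop :=
  ν.Next xr ur xr ∧
    ∀ i ∈ ν.M, ν.U i *ᵥ xr ∈ ν.lam i • ν.X i ∧ ν.V i *ᵥ ur ∈ ν.lam i • ν.Uset i

/-- The invariance constraints admit terminal sets of positive sizes. -/
def NondegenerateTerminalSets : Prop :=
  ∃ α c d b mu, ∀ i ∈ ν.M, 0 < α i ∧ ν.InvarianceConstraint i α c d b mu

/-! ### Plug-and-play requests -/

section PlugAndPlay

variable (o ν : Network ι n m q r p)

/-- The subsystems that join: they are in the new network `ν` and not in the old network `o`. -/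
def joining : Finset ι := ν.M \ o.M

/-- The subsystems that leave. -/
def leaving : Finset ι := o.M \ ν.M

/-- The remaining subsystems with a joining or a leaving neighbour. -/
def affected : Finset ι :=
  {i ∈ ν.M ∩ o.M | (∃ j ∈ joining o ν, j ∈ ν.N i) ∨ ∃ j ∈ leaving o ν, j ∈ o.N i}

/-- The joining and the affected subsystems, together with all their neighbours. -/
def redesignSet : Finset ι :=
  (joining o ν ∪ affected o ν) ∪ (joining o ν ∪ affected o ν).biUnion ν.N

/-- The network `ν` arises from the network `o` through a plug-and-play request: subsystems that
are neither joining nor affected keep their dynamics, neighbours and terminal ingredients, and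
those that moreover have no joining or affected neighbour keep their stage costs and their
scalars `n_ij`. (A rejected request, after which `ν = o`, is included.) -/
structure PnPRequest : Prop where
  keep : ∀ i ∈ ν.M, i ∉ joining o ν ∪ affected o ν →
    ν.A i = o.A i ∧ ν.B i = o.B i ∧ ν.F i = o.F i ∧ ν.C i = o.C i ∧ ν.N i = o.N i ∧
    (∀ j ∈ ν.N i, ν.l i j = o.l i j) ∧ ν.K i = o.K i ∧ ν.P i = o.P i
  keep_cost : ∀ i ∈ ν.M, i ∉ redesignSet o ν →
    ν.Q i = o.Q i ∧ ν.R i = o.R i ∧ ∀ j ∈ ν.N i, ν.w i j = o.w i j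

end PlugAndPlay

end Network

/-!
The local matrix inequalities add up to the statement that the block diagonal form
`V e = ∑ i, e_iᵀ P_i e_i` decreases along the terminal closed loop by at least the stage cost:
the weights `n_ij` distribute each `P_j` among the neighbours of `j`, and sum to at most one. They
hold in the last network because a request leaves them untouched for every subsystem that is not
redesigned.

By the S-procedure and diagonal dominance, the invariance constraints make the product of the
terminal ellipsoids invariant under the terminal controller. Hence a feasible plan, shifted by one
step and continued with the terminal controller, is feasible at the next state, and the optimal
cost decreases by at least the `Q`-distance of the state to the artificial equilibrium. This
distance therefore tends to zero. The artificial equilibrium in turn tends to the target: by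
convexity it may be moved by a small fraction `β` of the way towards the target, which lowers the
offset cost to first order in `β`, while the tracking cost exceeds a multiple of that distance
only by `O(β²)`. Optimality thus bounds the offset by the distance.

The polyhedral terminal set need not be invariant. On a small sublevel set of the optimal cost,
however, the predicted terminal state is so close to the artificial equilibrium that terminal sets
of one fixed size, centred at that equilibrium, can be used for the shifted plan. They exist
because the equilibria lie in constraint sets that are tightened by `λ_i < 1`.
-/

section Quad

variable {a b : Type*} [Fintype a] [Fintype b]

lemma quad_zero (X : Matrix a a ℝ) : quad X 0 = 0 := by simp [quad]

lemma quad_smul (X : Matrix a a ℝ) (t : ℝ) (v : a → ℝ) : quad X (t • v) = t ^ 2 * quad X v := by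
  simp only [quad, Matrix.mulVec_smul, smul_dotProduct, dotProduct_smul, smul_eq_mul]
  ring

lemma continuous_quad (X : Matrix a a ℝ) : Continuous (quad X) :=
  continuous_id.dotProduct (continuous_const.matrix_mulVec continuous_id)

lemma quad_eq_sum (X : Matrix a a ℝ) (v : a → ℝ) :
    quad X v = ∑ k, ∑ l, X k l * v k * v l := by
  simp only [quad, dotProduct, Matrix.mulVec, Finset.mul_sum]
  exact Finset.sum_congr rfl fun k _ => Finset.sum_congr rfl fun l _ => by ring

lemma quad_transpose_mul_mul (X : Matrix a a ℝ) (Y : Matrix a b ℝ) (v : b → ℝ) :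
    quad (Yᵀ * X * Y) v = quad X (Y *ᵥ v) := by
  simp only [quad, ← Matrix.mulVec_mulVec, Matrix.dotProduct_mulVec, Matrix.vecMul_transpose]

omit [Fintype b] in
lemma isHermitian_transpose_mul_mul {X : Matrix a a ℝ} (hX : X.IsHermitian) (Y : Matrix a b ℝ) :
    (Yᵀ * X * Y).IsHermitian := by
  rw [← Matrix.conjTranspose_eq_transpose_of_trivial]
  exact Matrix.isHermitian_conjTranspose_mul_mul Y hX

lemma posSemidef_iff_quad_nonneg {X : Matrix a a ℝ} (hX : X.IsHermitian) :
    X.PosSemidef ↔ ∀ v, 0 ≤ quad X v := by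
  rw [Matrix.posSemidef_iff_dotProduct_mulVec, and_iff_right hX]
  rfl

lemma quad_blockDiagonal' {o : Type*} [Fintype o] [DecidableEq o] {a : o → Type*}
    [∀ i, Fintype (a i)] (X : ∀ i, Matrix (a i) (a i) ℝ) (v : (Σ i, a i) → ℝ) :
    quad (Matrix.blockDiagonal' X) v = ∑ i, quad (X i) fun k => v ⟨i, k⟩ := by
  simp only [quad_eq_sum, Fintype.sum_sigma]
  refine Finset.sum_congr rfl fun i _ => Finset.sum_congr rfl fun k _ => ?_
  rw [Finset.sum_eq_single i (fun j _ hj => by simp [Matrix.blockDiagonal'_apply_ne _ _ _ hj.symm])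
    (by simp)]
  simp only [Matrix.blockDiagonal'_apply_eq]

lemma quad_nonneg {X : Matrix a a ℝ} (hX : X.PosDef) (v : a → ℝ) : 0 ≤ quad X v := by
  simpa [quad] using hX.posSemidef.dotProduct_mulVec_nonneg v

lemma quad_pos {X : Matrix a a ℝ} (hX : X.PosDef) {v : a → ℝ} (hv : v ≠ 0) : 0 < quad X v := by
  simpa [quad] using hX.dotProduct_mulVec_pos hv

lemma eq_zero_of_quad_nonpos {X : Matrix a a ℝ} (hX : X.PosDef) {v : a → ℝ} (hv : quad X v ≤ 0) :
    v = 0 := by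
  by_contra hne
  exact (quad_pos hX hne).not_ge hv

lemma posDef_blockDiagonal' {o : Type*} [Finite o] [DecidableEq o] {a : o → Type*}
    [∀ i, Finite (a i)] {X : ∀ i, Matrix (a i) (a i) ℝ} (hX : ∀ i, (X i).PosDef) :
    (Matrix.blockDiagonal' X).PosDef := by
  cases nonempty_fintype o
  have := fun i => Fintype.ofFinite (a i)
  refine .of_dotProduct_mulVec_pos
    (Matrix.isHermitian_blockDiagonal'_iff.mpr fun i => (hX i).isHermitian) fun {v} hv => ?_
  obtain ⟨⟨i, k⟩, hik⟩ := Function.ne_iff.mp hv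
  have hpos : 0 < quad (Matrix.blockDiagonal' X) v := by
    rw [quad_blockDiagonal']
    exact Finset.sum_pos' (fun i _ => quad_nonneg (hX i) _)
      ⟨i, Finset.mem_univ i, quad_pos (hX i) fun h => hik (congrFun h k)⟩
  simpa [quad] using hpos

lemma quad_add_le {X : Matrix a a ℝ} (hX : X.PosDef) (v w : a → ℝ) :
    quad X (v + w) ≤ 2 * quad X v + 2 * quad X w := by
  have h := quad_nonneg hX (v - w)
  simp only [quad, Matrix.mulVec_add, Matrix.mulVec_sub, dotProduct_add, add_dotProduct,
    dotProduct_sub, sub_dotProduct] at *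
  linarith

lemma exists_le_mul_quad {X : Matrix a a ℝ} (hX : X.PosDef) {f : (a → ℝ) → ℝ} (hf : Continuous f)
    (hf_smul : ∀ (t : ℝ) v, f (t • v) = t ^ 2 * f v) :
    ∃ κ > 0, ∀ v, f v ≤ κ * quad X v := by
  have hne : ∀ v ∈ Metric.sphere (0 : a → ℝ) 1, v ≠ 0 := fun v hv =>
    ne_zero_of_mem_unit_sphere ⟨v, hv⟩
  obtain ⟨κ, hκ⟩ := (isCompact_sphere (0 : a → ℝ) 1).exists_bound_of_continuousOn
    (f := fun v => f v / quad X v)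
    (hf.continuousOn.div (continuous_quad X).continuousOn fun v hv => (quad_pos hX (hne v hv)).ne')
  refine ⟨max κ 1, by positivity, fun v => ?_⟩
  rcases eq_or_ne v 0 with rfl | hv
  · simpa [quad_zero] using (hf_smul 0 0).le
  have hv_norm : ‖v‖ ≠ 0 := norm_ne_zero_iff.mpr hv
  set w := ‖v‖⁻¹ • v with hw
  have hw_mem : w ∈ Metric.sphere (0 : a → ℝ) 1 := by simp [hw, norm_smul, hv_norm]
  have hvw : v = ‖v‖ • w := by rw [hw, smul_inv_smul₀ hv_norm]
  have hfw : f w ≤ max κ 1 * quad X w :=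
    (div_le_iff₀ (quad_pos hX (hne w hw_mem))).mp
      ((le_abs_self _).trans ((hκ w hw_mem).trans (le_max_left κ 1)))
  rw [hvw, hf_smul, quad_smul]
  nlinarith [sq_nonneg ‖v‖]

lemma exists_quad_le_mul_quad {X : Matrix a a ℝ} (hX : X.PosDef) (Y : Matrix a a ℝ) :
    ∃ κ > 0, ∀ v, quad Y v ≤ κ * quad X v :=
  exists_le_mul_quad hX (continuous_quad Y) (quad_smul Y)

lemma exists_sq_norm_le_mul_quad {X : Matrix a a ℝ} (hX : X.PosDef) :
    ∃ κ > 0, ∀ v, ‖v‖ ^ 2 ≤ κ * quad X v :=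
  exists_le_mul_quad hX (by fun_prop) fun t v => by
    rw [norm_smul, mul_pow, Real.norm_eq_abs, sq_abs]

lemma eventually_norm_le_of_quad_le {X : Matrix a a ℝ} (hX : X.PosDef) {η : ℝ} (hη : 0 < η) :
    ∀ᶠ δ in 𝓝[>] (0 : ℝ), ∀ v, quad X v ≤ δ → ‖v‖ ≤ η := by
  obtain ⟨κ, hκ, hbound⟩ := exists_sq_norm_le_mul_quad hX
  filter_upwards [Ioo_mem_nhdsGT (show 0 < η ^ 2 / κ by positivity)] with δ hδ v hv
  refine le_of_sq_le_sq ((hbound v).trans ?_) hη.le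
  calc κ * quad X v ≤ κ * (η ^ 2 / κ) := by gcongr; exact hv.trans hδ.2.le
    _ = η ^ 2 := by field_simp

lemma tendsto_quad_zero_iff {X : Matrix a a ℝ} (hX : X.PosDef) {β : Type*} {l : Filter β}
    {y : β → a → ℝ} : Tendsto (fun t => quad X (y t)) l (𝓝 0) ↔ Tendsto y l (𝓝 0) := by
  refine ⟨fun h => ?_, fun h => ?_⟩
  · obtain ⟨κ, -, hbound⟩ := exists_sq_norm_le_mul_quad hX
    have hsq : Tendsto (fun t => ‖y t‖ ^ 2) l (𝓝 0) :=
      squeeze_zero (fun t => sq_nonneg _) (fun t => hbound (y t)) (by simpa using h.const_mul κ)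
    rw [tendsto_zero_iff_norm_tendsto_zero]
    simpa [Real.sqrt_sq (norm_nonneg _)] using hsq.sqrt
  · simpa only [quad_zero, Function.comp_def] using ((continuous_quad X).tendsto 0).comp h

lemma neg_abs_mul_sq_add_sq_le (z v w : ℝ) : -(|z| * (v ^ 2 + w ^ 2)) ≤ 2 * (v * (z * w)) := by
  have hvw : 2 * (|v| * |w|) ≤ v ^ 2 + w ^ 2 := by
    nlinarith [sq_nonneg (|v| - |w|), sq_abs v, sq_abs w]
  have habs : |2 * (v * (z * w))| ≤ |z| * (v ^ 2 + w ^ 2) :=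
    calc |2 * (v * (z * w))| = |z| * (2 * (|v| * |w|)) := by simp only [abs_mul, abs_two]; ring
      _ ≤ |z| * (v ^ 2 + w ^ 2) := by gcongr
  exact (abs_le.mp habs).1

lemma neg_rowAbs_le_two_mul_dotProduct_mulVec (Y : Matrix a b ℝ) (v : a → ℝ) (w : b → ℝ) :
    -(∑ k, rowAbs Y k * v k ^ 2 + ∑ l, rowAbs Yᵀ l * w l ^ 2) ≤ 2 * (v ⬝ᵥ (Y *ᵥ w)) := by
  have hcomm : ∑ l, rowAbs Yᵀ l * w l ^ 2 = ∑ k, ∑ l, |Y k l| * w l ^ 2 := by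
    simp only [rowAbs, Matrix.transpose_apply, Finset.sum_mul]
    exact Finset.sum_comm
  rw [hcomm]
  simp only [rowAbs, dotProduct, Matrix.mulVec, Finset.sum_mul, Finset.mul_sum,
    ← Finset.sum_add_distrib, ← Finset.sum_neg_distrib, ← mul_add]
  exact Finset.sum_le_sum fun k _ => Finset.sum_le_sum fun l _ => neg_abs_mul_sq_add_sq_le _ _ _

lemma sum_dominance_le_quad {X : Matrix a a ℝ} (hX : X.IsHermitian) (v : a → ℝ) :
    ∑ k, (2 * X k k - rowAbs X k) * v k ^ 2 ≤ quad X v := by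
  classical
  -- `Y` has the same absolute values as `X`, so no separate treatment of the diagonal is needed.
  set Y := X - Matrix.diagonal fun k => 2 * X k k with hY
  have habs : ∀ k l, |Y k l| = |X k l| := fun k l => by
    rcases eq_or_ne k l with rfl | hkl
    · rw [hY, Matrix.sub_apply, Matrix.diagonal_apply_eq, ← abs_neg]
      congr 1
      ring
    · rw [hY, Matrix.sub_apply, Matrix.diagonal_apply_ne _ hkl, sub_zero]
  have hrow : ∀ k, rowAbs Y k = rowAbs X k := fun k => by simp only [rowAbs, habs]
  have hcol : ∀ k, rowAbs Yᵀ k = rowAbs X k := fun k => by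
    simp only [rowAbs, Matrix.transpose_apply, habs]
    refine Finset.sum_congr rfl fun l _ => ?_
    rw [← hX.apply l k, star_trivial]
  have hquad : v ⬝ᵥ (Y *ᵥ v) = quad X v - ∑ k, 2 * X k k * v k ^ 2 := by
    rw [hY, Matrix.sub_mulVec, dotProduct_sub, quad]
    congr 1
    simp only [dotProduct, Matrix.mulVec_diagonal]
    exact Finset.sum_congr rfl fun k _ => by ring
  have h := neg_rowAbs_le_two_mul_dotProduct_mulVec Y v v
  simp only [hrow, hcol, hquad] at h
  simp only [sub_mul, Finset.sum_sub_distrib]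
  linarith

lemma sum_mul_sq_le_sum_mul_quad {o : Type*} {J : Finset o} {mu : o → ℝ} {X : o → Matrix a a ℝ}
    (hmu : ∀ j ∈ J, 0 ≤ mu j) (hX : ∀ j ∈ J, (X j).IsHermitian) {s : a → ℝ}
    (hs : ∀ l, ∑ j ∈ J, mu j * rowAbs (X j) l + s l ≤ 2 * ∑ j ∈ J, mu j * X j l l) (v : a → ℝ) :
    ∑ l, s l * v l ^ 2 ≤ ∑ j ∈ J, mu j * quad (X j) v :=
  calc ∑ l, s l * v l ^ 2
      ≤ ∑ l, (∑ j ∈ J, mu j * (2 * X j l l - rowAbs (X j) l)) * v l ^ 2 := by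
        refine Finset.sum_le_sum fun l _ => mul_le_mul_of_nonneg_right ?_ (sq_nonneg _)
        simp only [mul_sub, Finset.sum_sub_distrib, mul_left_comm _ (2 : ℝ), ← Finset.mul_sum]
        linarith [hs l]
    _ = ∑ j ∈ J, mu j * ∑ l, (2 * X j l l - rowAbs (X j) l) * v l ^ 2 := by
        simp only [Finset.sum_mul, Finset.mul_sum, mul_assoc]
        exact Finset.sum_comm
    _ ≤ ∑ j ∈ J, mu j * quad (X j) v := Finset.sum_le_sum fun j hj =>
        mul_le_mul_of_nonneg_left (sum_dominance_le_quad (hX j hj) v) (hmu j hj)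

lemma exists_smul_eq_of_quad_le_sq {X : Matrix a a ℝ} (hX : X.PosDef) {α : ℝ} {v : a → ℝ}
    (hv : quad X v ≤ α ^ 2) : ∃ w, α • w = v ∧ quad X w ≤ 1 := by
  rcases eq_or_ne α 0 with rfl | hα
  · obtain rfl := eq_zero_of_quad_nonpos hX (by simpa using hv)
    exact ⟨0, smul_zero _, by simp [quad_zero]⟩
  · refine ⟨α⁻¹ • v, smul_inv_smul₀ hα v, ?_⟩
    rw [quad_smul, inv_pow]
    exact inv_mul_le_one_of_le₀ hv (sq_nonneg α)

variable [DecidableEq a]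

lemma quad_inv_mulVec {X : Matrix a a ℝ} (hX : X.PosDef) (v : a → ℝ) :
    quad X⁻¹ (X *ᵥ v) = quad X v := by
  have hdet : IsUnit X.det := (Matrix.isUnit_iff_isUnit_det X).mp hX.isUnit
  simp only [quad, Matrix.mulVec_mulVec, Matrix.nonsing_inv_mul X hdet, Matrix.one_mulVec]
  exact dotProduct_comm _ _

lemma dotProduct_le_sqrt_quad_inv_mul_sqrt_quad {X : Matrix a a ℝ} (hX : X.PosDef)
    (f v : a → ℝ) : f ⬝ᵥ v ≤ √(quad X⁻¹ f) * √(quad X v) := by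
  have hdet : IsUnit X.det := (Matrix.isUnit_iff_isUnit_det X).mp hX.isUnit
  set B := Matrix.toBilin' X
  have happly : ∀ w y, B w y = w ⬝ᵥ X *ᵥ y := Matrix.toBilin'_apply' X
  have hsymm : LinearMap.IsSymm B := ⟨fun w y => by
    rw [RingHom.id_apply, happly, happly, Matrix.dotProduct_mulVec, ← Matrix.mulVec_transpose,
      dotProduct_comm, ← Matrix.conjTranspose_eq_transpose_of_trivial, hX.isHermitian.eq]⟩
  obtain ⟨w, rfl⟩ : ∃ w, f = X *ᵥ w :=
    ⟨X⁻¹ *ᵥ f, by rw [Matrix.mulVec_mulVec, Matrix.mul_nonsing_inv X hdet, Matrix.one_mulVec]⟩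
  rw [quad_inv_mulVec hX, ← Real.sqrt_mul (quad_nonneg hX w)]
  refine Real.le_sqrt_of_sq_le ?_
  calc (X *ᵥ w ⬝ᵥ v) ^ 2 = B v w ^ 2 := by rw [happly, dotProduct_comm]
    _ ≤ B v v * B w w :=
        B.apply_sq_le_of_symm (fun y => (quad_nonneg hX y).trans_eq (happly y y).symm) hsymm v w
    _ = quad X w * quad X v := by rw [happly, happly, mul_comm, quad, quad]

lemma dotProduct_le_of_quad_le_sq {X : Matrix a a ℝ} (hX : X.PosDef) {α : ℝ} (hα : 0 ≤ α)
    {v : a → ℝ} (hv : quad X v ≤ α ^ 2) (f : a → ℝ) : f ⬝ᵥ v ≤ √(quad X⁻¹ f) * α :=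
  (dotProduct_le_sqrt_quad_inv_mul_sqrt_quad hX f v).trans <| by
    gcongr
    exact Real.sqrt_le_iff.mpr ⟨hα, hv⟩

lemma quad_le_sq_of_forall {X : Matrix a a ℝ} (hX : X.PosDef) {α : ℝ} (hα : 0 ≤ α) {y : a → ℝ}
    (h : ∀ v, 0 ≤ α * quad X⁻¹ v + 2 * (v ⬝ᵥ y) + α) : quad X y ≤ α ^ 2 := by
  have hline : ∀ t : ℝ, 0 ≤ α * (t ^ 2 * quad X y) - 2 * t * quad X y + α := fun t => by
    have ht := h (-t • (X *ᵥ y))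
    rw [quad_smul, quad_inv_mulVec hX, smul_dotProduct, dotProduct_comm (X *ᵥ y) y, smul_eq_mul,
      ← quad] at ht
    linarith
  rcases hα.eq_or_lt with rfl | hα
  · linarith [hline 1]
  · have hinv := hline α⁻¹
    field_simp at hinv
    linarith

lemma quad_le_sq_of_sProcedure {X : Matrix a a ℝ} (hX : X.PosDef) {α σ : ℝ} (hα : 0 ≤ α)
    {Y : Matrix a b ℝ} {s t : a → ℝ} {w : b → ℝ}
    (hdom : ∀ k, α * rowAbs X⁻¹ k + rowAbs Y k + t k ≤ 2 * α * X⁻¹ k k)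
    (hs : ∀ k, |s k| ≤ t k) (hw : ∑ l, rowAbs Yᵀ l * w l ^ 2 ≤ σ) (ht : ∑ k, t k ≤ α - σ) :
    quad X (Y *ᵥ w + s) ≤ α ^ 2 := by
  refine quad_le_sq_of_forall hX hα fun v => ?_
  have hinv : α * ∑ k, (2 * X⁻¹ k k - rowAbs X⁻¹ k) * v k ^ 2 ≤ α * quad X⁻¹ v :=
    mul_le_mul_of_nonneg_left (sum_dominance_le_quad hX.inv.isHermitian v) hα
  have hYw := neg_rowAbs_le_two_mul_dotProduct_mulVec Y v w
  have hvs : -(∑ k, t k * v k ^ 2 + ∑ k, t k) ≤ 2 * (v ⬝ᵥ s) := by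
    rw [dotProduct, Finset.mul_sum, ← Finset.sum_add_distrib, ← Finset.sum_neg_distrib]
    refine Finset.sum_le_sum fun k _ => ?_
    have h := neg_abs_mul_sq_add_sq_le (s k) (v k) 1
    nlinarith [hs k, sq_nonneg (v k)]
  have hdiag : ∑ k, rowAbs Y k * v k ^ 2 + ∑ k, t k * v k ^ 2
      ≤ α * ∑ k, (2 * X⁻¹ k k - rowAbs X⁻¹ k) * v k ^ 2 := by
    rw [Finset.mul_sum, ← Finset.sum_add_distrib]
    refine Finset.sum_le_sum fun k _ => ?_
    nlinarith [hdom k, sq_nonneg (v k)]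
  rw [dotProduct_add]
  linarith

lemma quad_le_sq_of_dominated {X : Matrix a a ℝ} (hX : X.PosDef) {α : ℝ} (hα : 0 ≤ α)
    {t y : a → ℝ} (hdom : ∀ k, t k + α * rowAbs X⁻¹ k ≤ 2 * α * X⁻¹ k k) (ht : ∑ k, t k ≤ α)
    (hy : ∀ k, |y k| ≤ t k) : quad X y ≤ α ^ 2 := by
  simpa using quad_le_sq_of_sProcedure hX hα (σ := 0) (Y := (0 : Matrix a Empty ℝ)) (w := 0)
    (fun k => by simpa [rowAbs, add_comm] using hdom k) hy (by simp) (by simpa using ht)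

end Quad

namespace Network

variable {ι : Type*} [DecidableEq ι]

section Selection

lemma sum_ite_mk_eq_mul {n : ι → ℕ} {s : Finset ι} {i : ι} (hi : i ∈ s) (a : Fin (n i))
    (f : (Σ j : s, Fin (n j)) → ℝ) :
    ∑ t, (if (⟨i, a⟩ : Σ j, Fin (n j)) = ⟨t.1, t.2⟩ then (1 : ℝ) else 0) * f t
      = f ⟨⟨i, hi⟩, a⟩ := by
  rw [Finset.sum_eq_single (⟨⟨i, hi⟩, a⟩ : Σ j : s, Fin (n j))]
  · simp
  · rintro ⟨⟨j, hj⟩, b⟩ _ hne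
    rw [if_neg, zero_mul]
    intro h
    obtain ⟨rfl, hab⟩ := Sigma.mk.inj_iff.mp h
    exact hne (by rw [eq_of_heq hab])
  · simp

variable {n m q r : ι → ℕ} {p : ℕ} (ν : Network ι n m q r p) {i j : ι}

lemma U_mulVec (hi : i ∈ ν.M) (x : ν.StateIdx → ℝ) : ν.U i *ᵥ x = fun a => x ⟨⟨i, hi⟩, a⟩ :=
  funext fun a => sum_ite_mk_eq_mul hi a x

lemma V_mulVec (hi : i ∈ ν.M) (u : ν.InputIdx → ℝ) : ν.V i *ᵥ u = fun a => u ⟨⟨i, hi⟩, a⟩ :=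
  funext fun a => sum_ite_mk_eq_mul hi a u

lemma W_mulVec (hi : i ∈ ν.M) (x : ν.StateIdx → ℝ) :
    ν.W i *ᵥ x = fun s => x ⟨⟨s.1, ν.N_subset i hi s.1.2⟩, s.2⟩ :=
  funext fun s => sum_ite_mk_eq_mul (ν.N_subset i hi s.1.2) s.2 x

lemma sel_mulVec (hi : i ∈ ν.M) (hj : j ∈ ν.N i) (y : ν.NbrIdx i → ℝ) :
    ν.sel i j *ᵥ y = fun a => y ⟨⟨j, hj⟩, a⟩ := by
  rw [sel, ← Matrix.mulVec_mulVec, ν.U_mulVec (ν.N_subset i hi hj)]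
  funext a
  rw [← sum_ite_mk_eq_mul hj a y]
  simp only [Matrix.mulVec, dotProduct, Matrix.transpose_apply, W, eq_comm]

lemma sel_mulVec_W_mulVec (hi : i ∈ ν.M) (hj : j ∈ ν.N i) (x : ν.StateIdx → ℝ) :
    ν.sel i j *ᵥ (ν.W i *ᵥ x) = ν.U j *ᵥ x := by
  rw [ν.sel_mulVec hi hj, ν.W_mulVec hi, ν.U_mulVec (ν.N_subset i hi hj)]

lemma eq_iff_forall_U_mulVec_eq {x y : ν.StateIdx → ℝ} :
    x = y ↔ ∀ i ∈ ν.M, ν.U i *ᵥ x = ν.U i *ᵥ y := by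
  refine ⟨fun h i _ => h ▸ rfl, fun h => ?_⟩
  funext ⟨⟨i, hi⟩, a⟩
  simpa only [ν.U_mulVec hi] using congrFun (h i hi) a

lemma eq_iff_forall_V_mulVec_eq {u v : ν.InputIdx → ℝ} :
    u = v ↔ ∀ i ∈ ν.M, ν.V i *ᵥ u = ν.V i *ᵥ v := by
  refine ⟨fun h i _ => h ▸ rfl, fun h => ?_⟩
  funext ⟨⟨i, hi⟩, a⟩
  simpa only [ν.V_mulVec hi] using congrFun (h i hi) a

/-- The stacked vector `ξ_{N_i}` of a family of local vectors. -/
def stackN (i : ι) (ξ : ∀ j, Fin (n j) → ℝ) : ν.NbrIdx i → ℝ := fun s => ξ s.1 s.2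

lemma stackN_surjective (i : ι) : Function.Surjective (ν.stackN i) := fun y =>
  ⟨fun j a => if hj : j ∈ ν.N i then y ⟨⟨j, hj⟩, a⟩ else 0, funext fun s => by simp [stackN]⟩

lemma sel_mulVec_stackN (hi : i ∈ ν.M) (hj : j ∈ ν.N i) (ξ : ∀ j, Fin (n j) → ℝ) :
    ν.sel i j *ᵥ ν.stackN i ξ = ξ j :=
  ν.sel_mulVec hi hj _

end Selection

section LocalLMI

variable {n m q r : ι → ℕ} {p : ℕ} (ν : Network ι n m q r p) {i : ι}

lemma Pij_eq (i j : ι) : ν.Pij i j = (ν.sel i j)ᵀ * ν.P j * ν.sel i j := by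
  simp only [Pij, sel, Matrix.transpose_mul, Matrix.transpose_transpose, Matrix.mul_assoc]

lemma quad_Pij (i j : ι) (y : ν.NbrIdx i → ℝ) :
    quad (ν.Pij i j) y = quad (ν.P j) (ν.sel i j *ᵥ y) := by
  rw [Pij_eq, quad_transpose_mul_mul]

lemma Pij_isHermitian (i : ι) {j : ι} (hj : j ∈ ν.M) : (ν.Pij i j).IsHermitian := by
  rw [Pij_eq]
  exact isHermitian_transpose_mul_mul (ν.P_posDef j hj).isHermitian _

lemma localLMI_iff_posSemidef (i : ι) : ν.LocalLMI i ↔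
    (∑ j ∈ ν.N i, ν.w i j • ν.Pij i j
      - ((ν.sel i i)ᵀ * ν.Q i * ν.sel i i + (ν.K i * ν.sel i i)ᵀ * ν.R i * (ν.K i * ν.sel i i))
      - (ν.Acl i)ᵀ * ν.P i * ν.Acl i).PosSemidef := by
  simp only [LocalLMI, sel, Matrix.transpose_mul, Matrix.transpose_transpose, Matrix.mul_assoc,
    Matrix.add_mul, Matrix.mul_add]

lemma localLMI_iff_forall_nbr (hi : i ∈ ν.M) : ν.LocalLMI i ↔ ∀ y : ν.NbrIdx i → ℝ,
    quad (ν.Q i) (ν.sel i i *ᵥ y) + quad (ν.R i) (ν.K i *ᵥ (ν.sel i i *ᵥ y))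
      + quad (ν.P i) (ν.Acl i *ᵥ y)
      ≤ ∑ j ∈ ν.N i, ν.w i j * quad (ν.P j) (ν.sel i j *ᵥ y) := by
  rw [localLMI_iff_posSemidef, posSemidef_iff_quad_nonneg]
  · refine forall_congr' fun y => ?_
    have hN : quad (∑ j ∈ ν.N i, ν.w i j • ν.Pij i j) y
        = ∑ j ∈ ν.N i, ν.w i j * quad (ν.P j) (ν.sel i j *ᵥ y) := by
      simp only [← quad_Pij]
      simp only [quad, Matrix.sum_mulVec, Matrix.smul_mulVec, dotProduct_sum, dotProduct_smul,
        smul_eq_mul]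
    have hlin : ∀ X Y Z Z' : Matrix (ν.NbrIdx i) (ν.NbrIdx i) ℝ,
        quad (X - (Y + Z) - Z') y = quad X y - (quad Y y + quad Z y) - quad Z' y := by
      simp [quad, Matrix.sub_mulVec, Matrix.add_mulVec]
    rw [hlin, hN, quad_transpose_mul_mul, quad_transpose_mul_mul, quad_transpose_mul_mul,
      ← Matrix.mulVec_mulVec, sub_sub, sub_nonneg]
  · have hPij : (∑ j ∈ ν.N i, ν.w i j • ν.Pij i j).IsHermitian := by
      rw [Matrix.IsHermitian, Matrix.conjTranspose_sum]
      refine Finset.sum_congr rfl fun j hj => ?_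
      rw [Matrix.conjTranspose_smul, (ν.Pij_isHermitian i (ν.N_subset i hi hj)).eq, star_trivial]
    have hQ := isHermitian_transpose_mul_mul (ν.Q_posDef i hi).isHermitian (ν.sel i i)
    have hR := isHermitian_transpose_mul_mul (ν.R_posDef i hi).isHermitian (ν.K i * ν.sel i i)
    exact (hPij.sub (hQ.add hR)).sub
      (isHermitian_transpose_mul_mul (ν.P_posDef i hi).isHermitian _)

/-- The successor state of subsystem `i` under its terminal gain when every subsystem `j` is in
the state `ξ j`: the value of `A_{N_i} + B_i K_i U_i W_iᵀ`, written in terms of those local data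
only that a plug-and-play request elsewhere in the network keeps. -/
def terminalSucc (i : ι) (ξ : ∀ j, Fin (n j) → ℝ) : Fin (n i) → ℝ :=
  ν.A i *ᵥ ξ i + ∑ k : Fin p, ∑ j ∈ (ν.N i).erase i,
    (ν.l i j k * (ν.C j k ⬝ᵥ ξ j - ν.C i k ⬝ᵥ ξ i)) • ν.F i k + ν.B i *ᵥ (ν.K i *ᵥ ξ i)

lemma Acl_mulVec (i : ι) (y : ν.NbrIdx i → ℝ) :
    ν.Acl i *ᵥ y = ν.AN i *ᵥ y + ν.B i *ᵥ (ν.K i *ᵥ (ν.sel i i *ᵥ y)) := by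
  simp only [Acl, Matrix.add_mulVec, Matrix.mulVec_mulVec, sel, Matrix.mul_assoc]

lemma Acl_mulVec_stackN (hi : i ∈ ν.M) (ξ : ∀ j, Fin (n j) → ℝ) :
    ν.Acl i *ᵥ ν.stackN i ξ = ν.terminalSucc i ξ := by
  rw [Acl_mulVec, terminalSucc]
  simp only [AN, Matrix.add_mulVec, Matrix.sum_mulVec, Matrix.smul_mulVec, ← Matrix.mulVec_mulVec,
    Matrix.vecMulVec_mulVec, sub_dotProduct, ← Matrix.dotProduct_mulVec, mul_smul,
    op_smul_eq_smul, ν.sel_mulVec_stackN hi (ν.self_mem_N i hi)]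
  congr 2
  refine Finset.sum_congr rfl fun k _ => Finset.sum_congr rfl fun j hj => ?_
  rw [ν.sel_mulVec_stackN hi (Finset.mem_of_mem_erase hj)]

lemma localLMI_iff_forall (hi : i ∈ ν.M) : ν.LocalLMI i ↔ ∀ ξ : ∀ j, Fin (n j) → ℝ,
    quad (ν.Q i) (ξ i) + quad (ν.R i) (ν.K i *ᵥ ξ i) + quad (ν.P i) (ν.terminalSucc i ξ)
      ≤ ∑ j ∈ ν.N i, ν.w i j * quad (ν.P j) (ξ j) := by
  rw [ν.localLMI_iff_forall_nbr hi, (ν.stackN_surjective i).forall]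
  refine forall_congr' fun ξ => ?_
  rw [ν.Acl_mulVec_stackN hi, ν.sel_mulVec_stackN hi (ν.self_mem_N i hi),
    Finset.sum_congr rfl fun j hj => by rw [ν.sel_mulVec_stackN hi hj]]

end LocalLMI

section Requests

variable {n m q r : ι → ℕ} {p : ℕ} {o ν : Network ι n m q r p} {i : ι}

lemma notMem_joining_union_affected_of_notMem_redesignSet (hi : i ∈ ν.M)
    (hout : i ∉ redesignSet o ν) : ∀ j ∈ ν.N i, j ∉ joining o ν ∪ affected o ν :=
  fun j hj hmem => hout (Finset.mem_union_right _ (Finset.mem_biUnion.mpr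
    ⟨j, hmem, ν.N_symm i hi j (ν.N_subset i hi hj) hj⟩))

lemma PnPRequest.terminalSucc_eq (h : PnPRequest o ν) (hi : i ∈ ν.M)
    (hout : i ∉ redesignSet o ν) : ν.terminalSucc i = o.terminalSucc i := by
  have hnot := notMem_joining_union_affected_of_notMem_redesignSet hi hout
  obtain ⟨hA, hB, hF, hC, hN, hl, hK, -⟩ := h.keep i hi (hnot i (ν.self_mem_N i hi))
  have hCj : ∀ j ∈ ν.N i, ν.C j = o.C j := fun j hj =>
    (h.keep j (ν.N_subset i hi hj) (hnot j hj)).2.2.2.1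
  funext ξ
  rw [terminalSucc, terminalSucc, hA, hB, hK, ← hN]
  congr 2
  refine Finset.sum_congr rfl fun k _ => Finset.sum_congr rfl fun j hj => ?_
  have hj := Finset.mem_of_mem_erase hj
  rw [hl j hj, hCj j hj, hC, hF]

lemma PnPRequest.localLMI (h : PnPRequest o ν) (hi : i ∈ ν.M) (hout : i ∉ redesignSet o ν)
    (hlmi : i ∈ o.M → o.LocalLMI i) : ν.LocalLMI i := by
  have hnot := notMem_joining_union_affected_of_notMem_redesignSet hi hout
  have hii := hnot i (ν.self_mem_N i hi)
  have hio : i ∈ o.M := by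
    by_contra hio
    exact hii (Finset.mem_union_left _ (Finset.mem_sdiff.mpr ⟨hi, hio⟩))
  have hP : ∀ j ∈ ν.N i, ν.P j = o.P j := fun j hj =>
    (h.keep j (ν.N_subset i hi hj) (hnot j hj)).2.2.2.2.2.2.2
  obtain ⟨-, -, -, -, hN, -, hK, -⟩ := h.keep i hi hii
  obtain ⟨hQ, hR, hw⟩ := h.keep_cost i hi hout
  rw [ν.localLMI_iff_forall hi, h.terminalSucc_eq hi hout, hP i (ν.self_mem_N i hi), hQ, hR, hK]
  intro ξ
  refine ((o.localLMI_iff_forall hio).mp (hlmi hio) ξ).trans_eq ?_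
  rw [← hN]
  exact Finset.sum_congr rfl fun j hj => by rw [hw j hj, hP j hj]

lemma localLMI_of_requests {k : ℕ} {net : ℕ → Network ι n m q r p}
    (hinit : ∀ i ∈ (net 0).M, (net 0).LocalLMI i)
    (hreq : ∀ s < k, PnPRequest (net s) (net (s + 1)))
    (hlmi : ∀ s < k, ∀ i ∈ redesignSet (net s) (net (s + 1)), (net (s + 1)).LocalLMI i) :
    ∀ i ∈ (net k).M, (net k).LocalLMI i := by
  induction k with
  | zero => exact hinit
  | succ k ih =>
    have ih := ih (fun s hs => hreq s (by omega)) (fun s hs => hlmi s (by omega))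
    intro i hi
    by_cases hr : i ∈ redesignSet (net k) (net (k + 1))
    · exact hlmi k (by omega) i hr
    · exact (hreq k (by omega)).localLMI hi hr (ih i)

end Requests

end Network

namespace Network

variable {ι : Type*} [DecidableEq ι]

section Stacked

variable {n m q r : ι → ℕ} {p : ℕ} (ν : Network ι n m q r p) {i : ι}

/-- The block diagonal matrix `diag(X_1, …, X_M)`, by which local gains, input matrices and cost
matrices act on the stacked vectors. -/
def diag {a b : ι → ℕ} (X : ∀ i, Matrix (Fin (a i)) (Fin (b i)) ℝ) :
    Matrix (Σ j : ν.M, Fin (a j)) (Σ j : ν.M, Fin (b j)) ℝ :=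
  Matrix.blockDiagonal' fun j : ν.M => X j

/-- The matrix of the stacked dynamics `x⁺ = A x + diag(B_1, …, B_M) u`; its block rows are
`A_{N_i} W_i`. -/
def bigA : Matrix ν.StateIdx ν.StateIdx ℝ := fun s => (ν.AN s.1 * ν.W s.1) s.2

/-- The matrix of the stacked terminal closed loop, in coordinates that are centred at an
equilibrium. -/
def bigAcl : Matrix ν.StateIdx ν.StateIdx ℝ := ν.bigA + ν.diag ν.B * ν.diag ν.K

lemma diag_mulVec {a b : ι → ℕ} (X : ∀ i, Matrix (Fin (a i)) (Fin (b i)) ℝ)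
    (v : (Σ j : ν.M, Fin (b j)) → ℝ) (j : ν.M) (k : Fin (a j)) :
    (ν.diag X *ᵥ v) ⟨j, k⟩ = (X j *ᵥ fun l => v ⟨j, l⟩) k := by
  simp only [diag, Matrix.mulVec, dotProduct, Fintype.sum_sigma]
  rw [Finset.sum_eq_single j (fun l _ hl => by simp [Matrix.blockDiagonal'_apply_ne _ _ _ hl.symm])
    (by simp)]
  simp only [Matrix.blockDiagonal'_apply_eq]

lemma U_diag_mulVec (hi : i ∈ ν.M) (X : ∀ i, Matrix (Fin (n i)) (Fin (m i)) ℝ)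
    (u : ν.InputIdx → ℝ) : ν.U i *ᵥ (ν.diag X *ᵥ u) = X i *ᵥ (ν.V i *ᵥ u) := by
  rw [ν.U_mulVec hi, ν.V_mulVec hi]
  exact funext fun _ => ν.diag_mulVec X u _ _

lemma V_diag_mulVec (hi : i ∈ ν.M) (X : ∀ i, Matrix (Fin (m i)) (Fin (n i)) ℝ)
    (x : ν.StateIdx → ℝ) : ν.V i *ᵥ (ν.diag X *ᵥ x) = X i *ᵥ (ν.U i *ᵥ x) := by
  rw [ν.V_mulVec hi, ν.U_mulVec hi]
  exact funext fun _ => ν.diag_mulVec X x _ _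

lemma U_bigA_mulVec (hi : i ∈ ν.M) (x : ν.StateIdx → ℝ) :
    ν.U i *ᵥ (ν.bigA *ᵥ x) = ν.AN i *ᵥ (ν.W i *ᵥ x) := by
  rw [ν.U_mulVec hi, Matrix.mulVec_mulVec]
  rfl

lemma bigAcl_mulVec (x : ν.StateIdx → ℝ) :
    ν.bigAcl *ᵥ x = ν.bigA *ᵥ x + ν.diag ν.B *ᵥ (ν.diag ν.K *ᵥ x) := by
  rw [bigAcl, Matrix.add_mulVec, ← Matrix.mulVec_mulVec]

lemma U_bigAcl_mulVec (hi : i ∈ ν.M) (x : ν.StateIdx → ℝ) :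
    ν.U i *ᵥ (ν.bigAcl *ᵥ x) = ν.Acl i *ᵥ (ν.W i *ᵥ x) := by
  rw [bigAcl_mulVec, Matrix.mulVec_add, ν.U_bigA_mulVec hi, ν.U_diag_mulVec hi,
    ν.V_diag_mulVec hi, Acl_mulVec, ν.sel_mulVec_W_mulVec hi (ν.self_mem_N i hi)]

lemma next_iff {x y : ν.StateIdx → ℝ} {u : ν.InputIdx → ℝ} :
    ν.Next x u y ↔ y = ν.bigA *ᵥ x + ν.diag ν.B *ᵥ u := by
  rw [eq_iff_forall_U_mulVec_eq]
  refine forall₂_congr fun i hi => ?_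
  rw [Matrix.mulVec_add, ν.U_bigA_mulVec hi, ν.U_diag_mulVec hi]

lemma quad_diag_state (X : ∀ i, Matrix (Fin (n i)) (Fin (n i)) ℝ) (x : ν.StateIdx → ℝ) :
    quad (ν.diag X) x = ∑ i ∈ ν.M, quad (X i) (ν.U i *ᵥ x) := by
  rw [diag, quad_blockDiagonal', ← Finset.sum_coe_sort ν.M]
  exact Finset.sum_congr rfl fun i _ => by rw [ν.U_mulVec i.2]

lemma quad_diag_input (X : ∀ i, Matrix (Fin (m i)) (Fin (m i)) ℝ) (u : ν.InputIdx → ℝ) :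
    quad (ν.diag X) u = ∑ i ∈ ν.M, quad (X i) (ν.V i *ᵥ u) := by
  rw [diag, quad_blockDiagonal', ← Finset.sum_coe_sort ν.M]
  exact Finset.sum_congr rfl fun i _ => by rw [ν.V_mulVec i.2]

lemma posDef_diag {a : ι → ℕ} {X : ∀ i, Matrix (Fin (a i)) (Fin (a i)) ℝ}
    (hX : ∀ i ∈ ν.M, (X i).PosDef) : (ν.diag X).PosDef :=
  posDef_blockDiagonal' fun j => hX j j.2

lemma posDef_diag_P : (ν.diag ν.P).PosDef := ν.posDef_diag ν.P_posDef

lemma posDef_diag_Q : (ν.diag ν.Q).PosDef := ν.posDef_diag ν.Q_posDef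

lemma posDef_diag_R : (ν.diag ν.R).PosDef := ν.posDef_diag ν.R_posDef

lemma posDef_diag_S : (ν.diag ν.S).PosDef := ν.posDef_diag ν.S_posDef

lemma quad_U_mulVec_le {X : ∀ i, Matrix (Fin (n i)) (Fin (n i)) ℝ}
    (hX : ∀ i ∈ ν.M, (X i).PosDef) (hi : i ∈ ν.M) (x : ν.StateIdx → ℝ) :
    quad (X i) (ν.U i *ᵥ x) ≤ quad (ν.diag X) x := by
  rw [quad_diag_state]
  exact Finset.single_le_sum (f := fun i => quad (X i) (ν.U i *ᵥ x))
    (fun j hj => quad_nonneg (hX j hj) _) hi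

lemma LocalLMI.quad_le {ν : Network ι n m q r p} (hi : i ∈ ν.M) (h : ν.LocalLMI i)
    (e : ν.StateIdx → ℝ) :
    quad (ν.Q i) (ν.U i *ᵥ e) + quad (ν.R i) (ν.K i *ᵥ (ν.U i *ᵥ e))
      + quad (ν.P i) (ν.Acl i *ᵥ (ν.W i *ᵥ e))
      ≤ ∑ j ∈ ν.M, ν.w i j * quad (ν.P j) (ν.U j *ᵥ e) := by
  have hN := (ν.localLMI_iff_forall_nbr hi).mp h (ν.W i *ᵥ e)
  rw [ν.sel_mulVec_W_mulVec hi (ν.self_mem_N i hi)] at hN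
  refine hN.trans_eq ?_
  rw [Finset.sum_congr rfl fun j hj => by rw [ν.sel_mulVec_W_mulVec hi hj]]
  refine Finset.sum_subset (ν.N_subset i hi) fun j hj hjN => ?_
  rw [ν.w_zero i hi j hj fun hij => hjN (ν.N_symm j hj i hi hij), zero_mul]

lemma stageCost_add_quad_bigAcl_le (hlmi : ∀ i ∈ ν.M, ν.LocalLMI i) (e : ν.StateIdx → ℝ) :
    quad (ν.diag ν.Q) e + quad (ν.diag ν.R) (ν.diag ν.K *ᵥ e)
      + quad (ν.diag ν.P) (ν.bigAcl *ᵥ e) ≤ quad (ν.diag ν.P) e := by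
  rw [quad_diag_state, quad_diag_input, quad_diag_state, ← Finset.sum_add_distrib,
    ← Finset.sum_add_distrib]
  calc _ ≤ ∑ i ∈ ν.M, ∑ j ∈ ν.M, ν.w i j * quad (ν.P j) (ν.U j *ᵥ e) := by
        refine Finset.sum_le_sum fun i hi => ?_
        rw [ν.V_diag_mulVec hi, ν.U_bigAcl_mulVec hi]
        exact (hlmi i hi).quad_le hi e
    _ = ∑ j ∈ ν.M, (∑ i ∈ ν.M, ν.w i j) * quad (ν.P j) (ν.U j *ᵥ e) := by
        rw [Finset.sum_comm]
        simp only [Finset.sum_mul]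
    _ ≤ ∑ j ∈ ν.M, quad (ν.P j) (ν.U j *ᵥ e) := Finset.sum_le_sum fun j hj =>
        mul_le_of_le_one_left (quad_nonneg (ν.P_posDef j hj) _) (ν.w_sum j hj)
    _ = quad (ν.diag ν.P) e := (ν.quad_diag_state ν.P e).symm

lemma quad_bigAcl_le (hlmi : ∀ i ∈ ν.M, ν.LocalLMI i) (e : ν.StateIdx → ℝ) :
    quad (ν.diag ν.P) (ν.bigAcl *ᵥ e) ≤ quad (ν.diag ν.P) e := by
  have h := ν.stageCost_add_quad_bigAcl_le hlmi e
  linarith [quad_nonneg ν.posDef_diag_Q e, quad_nonneg ν.posDef_diag_R (ν.diag ν.K *ᵥ e)]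

end Stacked

section Invariance

variable {n m q r : ι → ℕ} {p : ℕ} {ν : Network ι n m q r p} {i : ι}

lemma exists_αN_mulVec_eq (hi : i ∈ ν.M) {α : ι → ℝ} {e : ν.StateIdx → ℝ}
    (he : ∀ j ∈ ν.N i, quad (ν.P j) (ν.U j *ᵥ e) ≤ α j ^ 2) :
    ∃ w, ν.αN i α *ᵥ w = ν.W i *ᵥ e ∧ ∀ j ∈ ν.N i, quad (ν.P j) (ν.sel i j *ᵥ w) ≤ 1 := by
  choose! ξ hξ_smul hξ_quad using fun j hj =>
    exists_smul_eq_of_quad_le_sq (ν.P_posDef j (ν.N_subset i hi hj)) (he j hj)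
  refine ⟨ν.stackN i ξ, ?_, fun j hj => ?_⟩
  · funext ⟨⟨j, hj⟩, a⟩
    have hja := congrFun (hξ_smul j hj) a
    rw [ν.U_mulVec (ν.N_subset i hi hj)] at hja
    rw [αN, Matrix.mulVec_diagonal, ν.W_mulVec hi]
    exact hja
  · rw [ν.sel_mulVec_stackN hi hj]
    exact hξ_quad j hj

lemma InvarianceConstraint.quad_le (hi : i ∈ ν.M) {α : ι → ℝ} {c : ν.StateIdx → ℝ}
    {d : ν.InputIdx → ℝ} {b : ν.StateIdx → ℝ} {mu : ι → ι → ℝ}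
    (h : ν.InvarianceConstraint i α c d b mu) (hα : ∀ j ∈ ν.N i, 0 ≤ α j) {e : ν.StateIdx → ℝ}
    (he : ∀ j ∈ ν.N i, quad (ν.P j) (ν.U j *ᵥ e) ≤ α j ^ 2) :
    quad (ν.P i) (ν.Acl i *ᵥ (ν.W i *ᵥ e)
      + (ν.Acl i *ᵥ (ν.W i *ᵥ c) + ν.B i *ᵥ (ν.V i *ᵥ d) - ν.U i *ᵥ c)) ≤ α i ^ 2 := by
  obtain ⟨hP, hb, hPij, hsum, hmu⟩ := h
  obtain ⟨w, hw, hw_quad⟩ := exists_αN_mulVec_eq hi he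
  have habs : (ν.Acl i).map abs * ν.αN i α = (ν.Acl i * ν.αN i α).map abs := by
    ext k l
    simp only [αN, Matrix.mul_diagonal, Matrix.map_apply, abs_mul, abs_of_nonneg (hα l.1 l.1.2)]
  rw [habs] at hP hPij
  rw [← hw, Matrix.mulVec_mulVec]
  refine quad_le_sq_of_sProcedure (ν.P_posDef i hi) (hα i (ν.self_mem_N i hi)) hP hb ?_ hsum
  calc ∑ l, rowAbs (ν.Acl i * ν.αN i α)ᵀ l * w l ^ 2
      ≤ ∑ j ∈ ν.N i, mu i j * quad (ν.Pij i j) w :=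
        sum_mul_sq_le_sum_mul_quad hmu (fun j hj => ν.Pij_isHermitian i (ν.N_subset i hi hj))
          hPij w
    _ ≤ ∑ j ∈ ν.N i, mu i j := Finset.sum_le_sum fun j hj => by
        rw [quad_Pij]
        exact mul_le_of_le_one_right (hmu j hj) (hw_quad j hj)

lemma dominated_subset_ellipsoid {d : ℕ} {P : Matrix (Fin d) (Fin d) ℝ} (hP : P.PosDef)
    (c : Fin d → ℝ) {α : ℝ} (hα : 0 ≤ α) : dominated d P c α ⊆ ellipsoid d P c α := by
  rintro x ⟨bb, hdom, hsum, hx⟩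
  exact quad_le_sq_of_dominated hP hα hdom hsum fun j => abs_le.mpr (hx j)

end Invariance

end Network

section Polytope

variable {a b : Type*} [Fintype b]

lemma mem_smul_polytope {G : Matrix a b ℝ} {g : a → ℝ} {t : ℝ} (ht : 0 < t) {x : b → ℝ} :
    x ∈ t • {y | G *ᵥ y ≤ g} ↔ ∀ k, G k ⬝ᵥ x ≤ t * g k := by
  rw [Set.mem_smul_set_iff_inv_smul_mem₀ ht.ne']
  refine forall_congr' fun k => ?_
  rw [Matrix.mulVec_smul, Pi.smul_apply, smul_eq_mul, inv_mul_le_iff₀ ht]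
  rfl

lemma eventually_mul_le (s : ℝ) {c : ℝ} (hc : 0 < c) : ∀ᶠ t : ℝ in 𝓝[>] 0, s * t ≤ c := by
  have hlim : Tendsto (fun t : ℝ => s * t) (𝓝[>] 0) (𝓝 0) :=
    tendsto_nhdsWithin_of_tendsto_nhds (Continuous.tendsto' (by fun_prop) _ _ (mul_zero s))
  exact hlim.eventually (eventually_le_nhds hc)

lemma rhs_pos_of_zero_mem_interior {G : Matrix a b ℝ} {g : a → ℝ}
    (h : (0 : b → ℝ) ∈ interior {y | G *ᵥ y ≤ g}) {k : a} (hG : G k ≠ 0) : 0 < g k := by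
  have hlim : Tendsto (fun t : ℝ => t • G k) (𝓝[>] 0) (𝓝 0) :=
    tendsto_nhdsWithin_of_tendsto_nhds
      (Continuous.tendsto' (by fun_prop) _ _ (zero_smul ℝ (G k)))
  obtain ⟨t, ht, ht_pos⟩ :=
    ((hlim.eventually (mem_interior_iff_mem_nhds.mp h)).and self_mem_nhdsWithin).exists
  have hle : t * (G k ⬝ᵥ G k) ≤ g k := by
    rw [← smul_eq_mul, ← dotProduct_smul]
    exact ht k
  have hGG : 0 < G k ⬝ᵥ G k :=
    (Finset.sum_nonneg fun _ _ => mul_self_nonneg _).lt_of_ne'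
      (dotProduct_self_eq_zero.not.mpr hG)
  exact (mul_pos ht_pos hGG).trans_le hle

lemma eventually_mul_le_rhs [Finite a] {G : Matrix a b ℝ} {g : a → ℝ}
    (h : (0 : b → ℝ) ∈ interior {y | G *ᵥ y ≤ g}) {f : (b → ℝ) → ℝ} (hf : f 0 = 0) {c : ℝ}
    (hc : 0 < c) : ∀ᶠ t : ℝ in 𝓝[>] 0, ∀ k, f (G k) * t ≤ c * g k := by
  refine Filter.eventually_all.mpr fun k => ?_
  by_cases hG : G k = 0
  · have hg : 0 ≤ g k := by simpa using interior_subset h k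
    exact Eventually.of_forall fun t => by
      rw [hG, hf, zero_mul]
      positivity
  · exact eventually_mul_le _ (mul_pos hc (rhs_pos_of_zero_mem_interior h hG))

end Polytope

namespace Network

variable {ι : Type*} [DecidableEq ι]

section AdmissibleTarget

variable {n m q r : ι → ℕ} {p : ℕ} {ν : Network ι n m q r p}

lemma admissibleTarget_iff {xe : ν.StateIdx → ℝ} {ue : ν.InputIdx → ℝ} :
    ν.AdmissibleTarget xe ue ↔ ν.Next xe ue xe ∧ ∀ i ∈ ν.M,
      (∀ k, ν.G i k ⬝ᵥ (ν.U i *ᵥ xe) ≤ ν.lam i * ν.g i k) ∧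
      ∀ k, ν.H i k ⬝ᵥ (ν.V i *ᵥ ue) ≤ ν.lam i * ν.h i k :=
  and_congr_right fun _ => forall₂_congr fun i hi =>
    and_congr (mem_smul_polytope (ν.lam_mem i hi).1) (mem_smul_polytope (ν.lam_mem i hi).1)

lemma Next.lineMap {x y x' y' : ν.StateIdx → ℝ} {u u' : ν.InputIdx → ℝ} (h : ν.Next x u y)
    (h' : ν.Next x' u' y') (t : ℝ) :
    ν.Next (AffineMap.lineMap x x' t) (AffineMap.lineMap u u' t) (AffineMap.lineMap y y' t) := by
  rw [next_iff] at *
  simp only [AffineMap.lineMap_apply_module, h, h', Matrix.mulVec_add, Matrix.mulVec_smul,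
    smul_add]
  abel

lemma AdmissibleTarget.lineMap {xe xr : ν.StateIdx → ℝ} {ue ur : ν.InputIdx → ℝ}
    (he : ν.AdmissibleTarget xe ue) (hr : ν.AdmissibleTarget xr ur) {t : ℝ}
    (ht : t ∈ Set.Icc (0 : ℝ) 1) :
    ν.AdmissibleTarget (AffineMap.lineMap xe xr t) (AffineMap.lineMap ue ur t) := by
  rw [admissibleTarget_iff] at *
  have hle : ∀ {a b c : ℝ}, a ≤ c → b ≤ c → (1 - t) * a + t * b ≤ c := fun {a b c} ha hb => by
    nlinarith [ht.1, ht.2]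
  refine ⟨he.1.lineMap hr.1 t, fun i hi => ⟨fun k => ?_, fun k => ?_⟩⟩
  · simpa only [AffineMap.lineMap_apply_module, Matrix.mulVec_add, Matrix.mulVec_smul,
      dotProduct_add, dotProduct_smul, smul_eq_mul] using
      hle ((he.2 i hi).1 k) ((hr.2 i hi).1 k)
  · simpa only [AffineMap.lineMap_apply_module, Matrix.mulVec_add, Matrix.mulVec_smul,
      dotProduct_add, dotProduct_smul, smul_eq_mul] using
      hle ((he.2 i hi).2 k) ((hr.2 i hi).2 k)

end AdmissibleTarget

section TerminalParams

variable {n m q r : ι → ℕ} {p : ℕ} {ν : Network ι n m q r p} {i : ι} {α : ι → ℝ}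
  {c : ν.StateIdx → ℝ} {d : ν.InputIdx → ℝ} {b : ν.StateIdx → ℝ} {mu : ι → ι → ℝ}

/-- The constraints of the optimal control problem that involve only the parameters of the
terminal sets. -/
structure TerminalParams (ν : Network ι n m q r p) (α : ι → ℝ) (c : ν.StateIdx → ℝ)
    (d : ν.InputIdx → ℝ) (b : ν.StateIdx → ℝ) (mu : ι → ι → ℝ) : Prop where
  size : ∀ i ∈ ν.M, 0 ≤ α i
  invariance : ∀ i ∈ ν.M, ν.InvarianceConstraint i α c d b mu
  term_state : ∀ i ∈ ν.M, ∀ k,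
    ν.G i k ⬝ᵥ (ν.U i *ᵥ c) + √(quad (ν.P i)⁻¹ (ν.G i k)) * α i ≤ ν.g i k
  term_input : ∀ i ∈ ν.M, ∀ l,
    ν.H i l ⬝ᵥ (ν.K i *ᵥ (ν.U i *ᵥ c)) + ν.H i l ⬝ᵥ (ν.V i *ᵥ d)
      + √(quad (ν.P i)⁻¹ (ν.H i l ᵥ* ν.K i)) * α i ≤ ν.h i l

lemma TerminalParams.mem_X (h : ν.TerminalParams α c d b mu) (hi : i ∈ ν.M) {x : Fin (n i) → ℝ}
    (hx : x ∈ ellipsoid _ (ν.P i) (ν.U i *ᵥ c) (α i)) : x ∈ ν.X i := fun k => by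
  have hGx := dotProduct_le_of_quad_le_sq (ν.P_posDef i hi) (h.size i hi) hx (ν.G i k)
  rw [dotProduct_sub] at hGx
  change ν.G i k ⬝ᵥ x ≤ _
  linarith [h.term_state i hi k]

lemma TerminalParams.mem_Uset (h : ν.TerminalParams α c d b mu) (hi : i ∈ ν.M)
    {x : Fin (n i) → ℝ} (hx : x ∈ ellipsoid _ (ν.P i) (ν.U i *ᵥ c) (α i)) :
    ν.K i *ᵥ x + ν.V i *ᵥ d ∈ ν.Uset i := fun k => by
  have hHx := dotProduct_le_of_quad_le_sq (ν.P_posDef i hi) (h.size i hi) hx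
    (ν.H i k ᵥ* ν.K i)
  rw [← Matrix.dotProduct_mulVec, Matrix.mulVec_sub, dotProduct_sub] at hHx
  change ν.H i k ⬝ᵥ (ν.K i *ᵥ x + ν.V i *ᵥ d) ≤ _
  rw [dotProduct_add]
  linarith [h.term_input i hi k]

lemma InvarianceConstraint.U_b_nonneg (h : ν.InvarianceConstraint i α c d b mu) :
    0 ≤ ν.U i *ᵥ b := fun k => (abs_nonneg _).trans (h.2.1 k)

lemma InvarianceConstraint.smul_of_next (h : ν.InvarianceConstraint i α c d b mu) (hi : i ∈ ν.M)
    {t : ℝ} (ht : 0 ≤ t) {xe : ν.StateIdx → ℝ} {ue : ν.InputIdx → ℝ} (he : ν.Next xe ue xe) :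
    ν.InvarianceConstraint i (t • α) xe (ue - ν.diag ν.K *ᵥ xe) 0 (t • mu) := by
  have hb := h.U_b_nonneg
  obtain ⟨hP, -, hPij, hsum, hmu⟩ := h
  have hα : ν.αN i (t • α) = t • ν.αN i α := by
    rw [αN, αN, ← Matrix.diagonal_smul]
    rfl
  have hcentre : ν.Acl i *ᵥ ν.W i *ᵥ xe + ν.B i *ᵥ ν.V i *ᵥ (ue - ν.diag ν.K *ᵥ xe)
      - ν.U i *ᵥ xe = 0 := by
    rw [he i hi, Acl_mulVec, ν.sel_mulVec_W_mulVec hi (ν.self_mem_N i hi), Matrix.mulVec_sub,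
      ν.V_diag_mulVec hi, Matrix.mulVec_sub]
    abel
  rw [InvarianceConstraint, hα, Matrix.mulVec_zero, hcentre]
  simp only [Matrix.mul_smul, Matrix.smul_apply, Matrix.transpose_smul, smul_eq_mul, Pi.smul_apply,
    ← Finset.mul_sum, mul_assoc, Pi.zero_apply, abs_zero, Finset.sum_const_zero]
  refine ⟨fun k => ?_, fun _ => le_rfl, fun k => ?_, ?_, fun j hj => mul_nonneg ht (hmu j hj)⟩
  · nlinarith [mul_le_mul_of_nonneg_left (hP k) ht, mul_nonneg ht (hb k)]
  · linarith [mul_le_mul_of_nonneg_left (hPij k) ht]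
  · linarith [mul_le_mul_of_nonneg_left ((Finset.sum_nonneg fun k _ => hb k).trans hsum) ht]

lemma mem_dominated_iff_sub_mem {d : ℕ} {P : Matrix (Fin d) (Fin d) ℝ} {c x : Fin d → ℝ} {α : ℝ} :
    x ∈ dominated d P c α ↔ x - c ∈ dominated d P 0 α := by
  simp [dominated]

lemma InvarianceConstraint.Acl_mulVec_mem_dominated (h : ν.InvarianceConstraint i α c d b mu)
    {η : ℝ} (hη : ∀ j ∈ ν.N i, η ≤ α j) (hrow : (∑ k, rowAbs (ν.Acl i) k) * η ≤ α i)
    {y : ν.NbrIdx i → ℝ} (hy : ‖y‖ ≤ η) :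
    ν.Acl i *ᵥ y ∈ dominated _ (ν.P i) 0 (α i) := by
  refine ⟨fun k => rowAbs (ν.Acl i) k * η, fun k => ?_, by rwa [← Finset.sum_mul], fun k => ?_⟩
  · have hαN : rowAbs (ν.Acl i) k * η ≤ ∑ l, ((ν.Acl i).map abs * ν.αN i α) k l := by
      rw [rowAbs, Finset.sum_mul]
      refine Finset.sum_le_sum fun l _ => ?_
      rw [αN, Matrix.mul_diagonal, Matrix.map_apply]
      exact mul_le_mul_of_nonneg_left (hη l.1 l.1.2) (abs_nonneg _)
    have hb : 0 ≤ (ν.U i *ᵥ b) k := h.U_b_nonneg k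
    change rowAbs (ν.Acl i) k * η + α i * rowAbs (ν.P i)⁻¹ k ≤ _
    linarith [h.1 k]
  · rw [Pi.zero_apply, sub_zero, ← abs_le]
    change |∑ l, ν.Acl i k l * y l| ≤ (∑ l, |ν.Acl i k l|) * η
    rw [Finset.sum_mul]
    refine (Finset.abs_sum_le_sum_abs _ _).trans (Finset.sum_le_sum fun l _ => ?_)
    rw [abs_mul]
    exact mul_le_mul_of_nonneg_left ((norm_le_pi_norm y l).trans hy) (abs_nonneg _)

end TerminalParams

section UniformTerminalSets

variable {n m q r : ι → ℕ} {p : ℕ} {ν : Network ι n m q r p} {α : ι → ℝ} {mu : ι → ι → ℝ}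

/-- The sizes `α` with the multipliers `mu` are feasible for terminal sets that are centred at any
admissible equilibrium, and these sets capture the sublevel set `δ` of the terminal cost: the
ellipsoids contain it, the polyhedral sets contain its image under the terminal closed loop. -/
structure UniformTerminalSets (ν : Network ι n m q r p) (δ : ℝ) (α : ι → ℝ) (mu : ι → ι → ℝ) :
    Prop where
  params : ∀ xe ue, ν.AdmissibleTarget xe ue →
    ν.TerminalParams α xe (ue - ν.diag ν.K *ᵥ xe) 0 mu
  mem_ellipsoid : ∀ e, quad (ν.diag ν.P) e ≤ δ → ∀ i ∈ ν.M, quad (ν.P i) (ν.U i *ᵥ e) ≤ α i ^ 2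
  bigAcl_mem_dominated : ∀ e, quad (ν.diag ν.P) e ≤ δ → ∀ i ∈ ν.M,
    ν.U i *ᵥ (ν.bigAcl *ᵥ e) ∈ dominated _ (ν.P i) 0 (α i)

lemma eventually_forall_terminalParams
    (hX : ∀ i ∈ ν.M, (0 : Fin (n i) → ℝ) ∈ interior (ν.X i))
    (hU : ∀ i ∈ ν.M, (0 : Fin (m i) → ℝ) ∈ interior (ν.Uset i)) {c : ν.StateIdx → ℝ}
    {d : ν.InputIdx → ℝ} {b : ν.StateIdx → ℝ} (hα : ∀ i ∈ ν.M, 0 ≤ α i)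
    (hinv : ∀ i ∈ ν.M, ν.InvarianceConstraint i α c d b mu) :
    ∀ᶠ t : ℝ in 𝓝[>] 0, ∀ xe ue, ν.AdmissibleTarget xe ue →
      ν.TerminalParams (t • α) xe (ue - ν.diag ν.K *ᵥ xe) 0 (t • mu) := by
  have hlam : ∀ i ∈ ν.M, 0 < 1 - ν.lam i := fun i hi => sub_pos.mpr (ν.lam_mem i hi).2
  have hstate : ∀ᶠ t : ℝ in 𝓝[>] 0, ∀ i ∈ ν.M, ∀ k,
      √(quad (ν.P i)⁻¹ (ν.G i k)) * α i * t ≤ (1 - ν.lam i) * ν.g i k :=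
    (Filter.eventually_all_finset _).mpr fun i hi => eventually_mul_le_rhs (hX i hi)
      (f := fun x => √(quad (ν.P i)⁻¹ x) * α i) (by simp [quad_zero]) (hlam i hi)
  have hinput : ∀ᶠ t : ℝ in 𝓝[>] 0, ∀ i ∈ ν.M, ∀ l,
      √(quad (ν.P i)⁻¹ (ν.H i l ᵥ* ν.K i)) * α i * t ≤ (1 - ν.lam i) * ν.h i l :=
    (Filter.eventually_all_finset _).mpr fun i hi => eventually_mul_le_rhs (hU i hi)
      (f := fun u => √(quad (ν.P i)⁻¹ (u ᵥ* ν.K i)) * α i) (by simp [quad_zero]) (hlam i hi)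
  filter_upwards [hstate, hinput, self_mem_nhdsWithin] with t hstate hinput ht xe ue hadm
  have ht : 0 ≤ t := le_of_lt ht
  have heq := hadm.1
  rw [admissibleTarget_iff] at hadm
  refine ⟨fun i hi => mul_nonneg ht (hα i hi), fun i hi => (hinv i hi).smul_of_next hi ht heq,
    fun i hi k => ?_, fun i hi k => ?_⟩
  · rw [Pi.smul_apply, smul_eq_mul]
    linarith [hstate i hi k, (hadm.2 i hi).1 k]
  · rw [Pi.smul_apply, smul_eq_mul, Matrix.mulVec_sub, ν.V_diag_mulVec hi, dotProduct_sub]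
    linarith [hinput i hi k, (hadm.2 i hi).2 k]

lemma eventually_uniformTerminalSets (hα : ∀ i ∈ ν.M, 0 < α i)
    (hparams : ∀ xe ue, ν.AdmissibleTarget xe ue →
      ν.TerminalParams α xe (ue - ν.diag ν.K *ᵥ xe) 0 mu)
    {c : ν.StateIdx → ℝ} {d : ν.InputIdx → ℝ} {b : ν.StateIdx → ℝ}
    (hinv : ∀ i ∈ ν.M, ν.InvarianceConstraint i α c d b mu) :
    ∀ᶠ δ in 𝓝[>] (0 : ℝ), ν.UniformTerminalSets δ α mu := by
  have hη_small : ∀ᶠ η in 𝓝[>] (0 : ℝ), ∀ i ∈ ν.M,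
      1 * η ≤ α i ∧ (∑ k, rowAbs (ν.Acl i) k) * η ≤ α i :=
    (Filter.eventually_all_finset _).mpr fun i hi =>
      (eventually_mul_le _ (hα i hi)).and (eventually_mul_le _ (hα i hi))
  obtain ⟨η, hη, hη_pos⟩ := (hη_small.and self_mem_nhdsWithin).exists
  have hδ_small : ∀ᶠ δ in 𝓝[>] (0 : ℝ), ∀ i ∈ ν.M, 1 * δ ≤ α i ^ 2 :=
    (Filter.eventually_all_finset _).mpr fun i hi => eventually_mul_le _ (pow_pos (hα i hi) 2)
  filter_upwards [hδ_small, eventually_norm_le_of_quad_le ν.posDef_diag_P hη_pos] with δ hδ hnorm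
  refine ⟨hparams, fun e he i hi => ?_, fun e he i hi => ?_⟩
  · exact (ν.quad_U_mulVec_le ν.P_posDef hi e).trans (he.trans (by simpa using hδ i hi))
  · rw [ν.U_bigAcl_mulVec hi]
    refine (hinv i hi).Acl_mulVec_mem_dominated
      (fun j hj => by simpa using (hη j (ν.N_subset i hi hj)).1) (hη i hi).2 ?_
    rw [ν.W_mulVec hi]
    exact (pi_norm_le_iff_of_nonneg hη_pos.le).mpr fun s =>
      (norm_le_pi_norm e _).trans (hnorm e he)

lemma exists_uniformTerminalSets
    (hX : ∀ i ∈ ν.M, (0 : Fin (n i) → ℝ) ∈ interior (ν.X i))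
    (hU : ∀ i ∈ ν.M, (0 : Fin (m i) → ℝ) ∈ interior (ν.Uset i))
    (hterm : ν.NondegenerateTerminalSets) :
    ∃ δ > 0, ∃ α mu, ν.UniformTerminalSets δ α mu := by
  obtain ⟨α, c, d, b, mu, hterm⟩ := hterm
  obtain ⟨t, hparams, ht⟩ := ((eventually_forall_terminalParams hX hU
    (fun i hi => (hterm i hi).1.le) fun i hi => (hterm i hi).2).and self_mem_nhdsWithin).exists
  have ht : 0 < t := ht
  have hinv : ∀ i ∈ ν.M, ν.InvarianceConstraint i (t • α) 0 (0 - ν.diag ν.K *ᵥ 0) 0 (t • mu) :=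
    fun i hi => (hterm i hi).2.smul_of_next hi ht.le (ν.next_iff.mpr (by simp))
  obtain ⟨δ, hδ, hδ_pos⟩ := ((eventually_uniformTerminalSets
    (fun i hi => mul_pos ht (hterm i hi).1) hparams hinv).and self_mem_nhdsWithin).exists
  exact ⟨δ, hδ_pos, t • α, t • mu, hδ⟩

end UniformTerminalSets

end Network

namespace Network

variable {ι : Type*} [DecidableEq ι]

section Cost

variable {n m q r : ι → ℕ} {p : ℕ} (ν : Network ι n m q r p) {T : ℕ} (xr : ν.StateIdx → ℝ)
  (z : ν.Plan)

lemma cost_eq_quad_diag :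
    ν.cost T xr z = ∑ t ∈ Finset.range T,
        (quad (ν.diag ν.Q) (z.x t - z.xe) + quad (ν.diag ν.R) (z.u t - z.ue))
      + quad (ν.diag ν.P) (z.x T - z.xe) + quad (ν.diag ν.S) (z.xe - xr) := by
  simp only [cost, quad_diag_state, quad_diag_input, Matrix.mulVec_sub, ← Finset.sum_add_distrib]
  rw [Finset.sum_comm, ← Finset.sum_add_distrib, ← Finset.sum_add_distrib]

lemma stageCost_nonneg (x : ν.StateIdx → ℝ) (u : ν.InputIdx → ℝ) :
    0 ≤ quad (ν.diag ν.Q) x + quad (ν.diag ν.R) u :=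
  add_nonneg (quad_nonneg ν.posDef_diag_Q x) (quad_nonneg ν.posDef_diag_R u)

lemma quad_terminal_le_cost : quad (ν.diag ν.P) (z.x T - z.xe) ≤ ν.cost T xr z := by
  rw [cost_eq_quad_diag]
  have hstage := Finset.sum_nonneg fun t (_ : t ∈ Finset.range T) =>
    ν.stageCost_nonneg (z.x t - z.xe) (z.u t - z.ue)
  linarith [quad_nonneg ν.posDef_diag_S (z.xe - xr)]

lemma quad_initial_add_quad_offset_le_cost (hT : 1 ≤ T) :
    quad (ν.diag ν.Q) (z.x 0 - z.xe) + quad (ν.diag ν.S) (z.xe - xr) ≤ ν.cost T xr z := by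
  rw [cost_eq_quad_diag]
  have hstage := Finset.single_le_sum
    (f := fun t => quad (ν.diag ν.Q) (z.x t - z.xe) + quad (ν.diag ν.R) (z.u t - z.ue))
    (fun t _ => ν.stageCost_nonneg _ _) (Finset.mem_range.mpr hT)
  linarith [quad_nonneg ν.posDef_diag_P (z.x T - z.xe),
    quad_nonneg ν.posDef_diag_R (z.u 0 - z.ue)]

end Cost

section Feasible

variable {n m q r : ι → ℕ} {p : ℕ} {ν : Network ι n m q r p} {Xf : TerminalConstraint} {T : ℕ}
  {x₀ : ν.StateIdx → ℝ} {z : ν.Plan}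

namespace Feasible

lemma admissibleTarget (h : ν.Feasible Xf T x₀ z) : ν.AdmissibleTarget z.xe z.ue :=
  ⟨h.eq_dyn, fun i hi => ⟨h.eq_state i hi, h.eq_input i hi⟩⟩

lemma terminalParams (h : ν.Feasible Xf T x₀ z) : ν.TerminalParams z.α z.c z.d z.b z.mu :=
  ⟨h.size, h.invariance, h.term_state, h.term_input⟩

lemma ue_eq (h : ν.Feasible Xf T x₀ z) : z.ue = ν.diag ν.K *ᵥ z.xe + z.d :=
  (ν.eq_iff_forall_V_mulVec_eq).mpr fun i hi => by
    rw [h.eq_ctrl i hi, Matrix.mulVec_add, ν.V_diag_mulVec hi]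

lemma terminal_input_sub_ue (h : ν.Feasible Xf T x₀ z) (x : ν.StateIdx → ℝ) :
    ν.diag ν.K *ᵥ x + z.d - z.ue = ν.diag ν.K *ᵥ (x - z.xe) := by
  rw [h.ue_eq, Matrix.mulVec_sub]
  abel

lemma next_terminal (h : ν.Feasible Xf T x₀ z) (x : ν.StateIdx → ℝ) :
    ν.Next x (ν.diag ν.K *ᵥ x + z.d) (z.xe + ν.bigAcl *ᵥ (x - z.xe)) := by
  have hxe := ν.next_iff.mp h.eq_dyn
  rw [h.ue_eq, Matrix.mulVec_add] at hxe
  rw [next_iff]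
  nth_rewrite 1 [hxe]
  rw [Matrix.mulVec_sub, bigAcl_mulVec, bigAcl_mulVec, Matrix.mulVec_add]
  abel

lemma terminal_succ_mem_ellipsoid (h : ν.Feasible ellipsoid T x₀ z) {i : ι} (hi : i ∈ ν.M) :
    ν.U i *ᵥ (z.xe + ν.bigAcl *ᵥ (z.x T - z.xe))
      ∈ ellipsoid _ (ν.P i) (ν.U i *ᵥ z.c) (z.α i) := by
  have hN := ν.N_subset i hi
  have hquad := (h.invariance i hi).quad_le hi (e := z.x T - z.c) (fun j hj => h.size j (hN hj))
    fun j hj => by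
      rw [Matrix.mulVec_sub]
      exact h.terminal j (hN hj)
  have hnext := h.next_terminal (z.x T) i hi
  change quad _ _ ≤ _
  convert hquad using 2
  rw [hnext, Acl_mulVec, Acl_mulVec, ν.sel_mulVec_W_mulVec hi (ν.self_mem_N i hi),
    ν.sel_mulVec_W_mulVec hi (ν.self_mem_N i hi)]
  simp only [Matrix.mulVec_add, Matrix.mulVec_sub, ν.V_diag_mulVec hi]
  abel

lemma mono {Xf' : TerminalConstraint} (h : ν.Feasible Xf T x₀ z)
    (hsub : ∀ i ∈ ν.M, ∀ c α, 0 ≤ α → Xf (n i) (ν.P i) c α ⊆ Xf' (n i) (ν.P i) c α) :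
    ν.Feasible Xf' T x₀ z :=
  { h with terminal := fun i hi => hsub i hi _ _ (h.size i hi) (h.terminal i hi) }

lemma of_dominated (h : ν.Feasible dominated T x₀ z) : ν.Feasible ellipsoid T x₀ z :=
  h.mono fun i hi c _ hα => dominated_subset_ellipsoid (ν.P_posDef i hi) c hα

end Feasible

/-- The plan `z` shifted by one step and continued with the terminal controller: the candidate at
the next measurement. -/
def shiftPlan (ν : Network ι n m q r p) (T : ℕ) (z : ν.Plan) : ν.Plan :=
  { z with
    x := fun t => if t < T then z.x (t + 1) else z.xe + ν.bigAcl *ᵥ (z.x T - z.xe)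
    u := fun t => if t + 1 < T then z.u (t + 1) else ν.diag ν.K *ᵥ z.x T + z.d }

lemma feasible_shiftPlan (h : ν.Feasible ellipsoid T x₀ z) (hT : 1 ≤ T)
    (hXf : ∀ i ∈ ν.M, ν.U i *ᵥ (z.xe + ν.bigAcl *ᵥ (z.x T - z.xe))
      ∈ Xf (n i) (ν.P i) (ν.U i *ᵥ z.c) (z.α i)) :
    ν.Feasible Xf T (z.x 1) (ν.shiftPlan T z) where
  init := if_pos hT
  dyn t ht := by
    dsimp only [shiftPlan]
    rw [if_pos ht]
    by_cases hlast : t + 1 < T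
    · simpa only [if_pos hlast] using h.dyn (t + 1) hlast
    · obtain rfl : T = t + 1 := by omega
      simpa only [lt_irrefl, if_false] using h.next_terminal _
  state t _ i hi := by
    dsimp only [shiftPlan]
    split_ifs with hlast
    · exact h.state (t + 1) hlast i hi
    · exact h.terminalParams.mem_X hi (h.terminal_succ_mem_ellipsoid hi)
  input t _ i hi := by
    dsimp only [shiftPlan]
    split_ifs with hlast
    · exact h.input (t + 1) hlast i hi
    · rw [Matrix.mulVec_add, ν.V_diag_mulVec hi]
      exact h.terminalParams.mem_Uset hi (h.terminal i hi)
  eq_dyn := h.eq_dyn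
  eq_state := h.eq_state
  eq_ctrl := h.eq_ctrl
  eq_input := h.eq_input
  size := h.size
  terminal i hi := by simpa only [shiftPlan, lt_irrefl, if_false] using hXf i hi
  invariance := h.invariance
  term_state := h.term_state
  term_input := h.term_input

lemma cost_shiftPlan_add_le (h : ν.Feasible Xf T x₀ z) (hT : 1 ≤ T)
    (hlmi : ∀ i ∈ ν.M, ν.LocalLMI i) (xr : ν.StateIdx → ℝ) :
    ν.cost T xr (ν.shiftPlan T z) + quad (ν.diag ν.Q) (x₀ - z.xe) ≤ ν.cost T xr z := by
  obtain ⟨T, rfl⟩ := Nat.exists_eq_add_of_le' hT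
  have hstages : ∑ t ∈ Finset.range T,
        (quad (ν.diag ν.Q) ((ν.shiftPlan (T + 1) z).x t - z.xe)
          + quad (ν.diag ν.R) ((ν.shiftPlan (T + 1) z).u t - z.ue))
      = ∑ t ∈ Finset.range T, (quad (ν.diag ν.Q) (z.x (t + 1) - z.xe)
          + quad (ν.diag ν.R) (z.u (t + 1) - z.ue)) :=
    Finset.sum_congr rfl fun t ht => by
      have ht : t < T := Finset.mem_range.mp ht
      simp only [shiftPlan, if_pos (Nat.lt_succ_of_lt ht), if_pos (Nat.succ_lt_succ ht)]
  have hlast := ν.stageCost_add_quad_bigAcl_le hlmi (z.x (T + 1) - z.xe)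
  rw [← h.terminal_input_sub_ue] at hlast
  rw [cost_eq_quad_diag, cost_eq_quad_diag, Finset.sum_range_succ, Finset.sum_range_succ',
    ← h.init]
  change (∑ t ∈ Finset.range T, (quad (ν.diag ν.Q) ((ν.shiftPlan (T + 1) z).x t - z.xe)
          + quad (ν.diag ν.R) ((ν.shiftPlan (T + 1) z).u t - z.ue)) + _) + _ + _ + _ ≤ _
  rw [hstages]
  simp only [shiftPlan, lt_irrefl, if_false, lt_add_iff_pos_right, zero_lt_one, if_true,
    add_sub_cancel_left]
  linarith [quad_nonneg ν.posDef_diag_R (z.u 0 - z.ue)]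

end Feasible

section TerminalPlan

variable {n m q r : ι → ℕ} {p : ℕ} {ν : Network ι n m q r p} {T : ℕ} {δ : ℝ} {α : ι → ℝ}
  {mu : ι → ι → ℝ} {x xe : ν.StateIdx → ℝ} {ue : ν.InputIdx → ℝ}

/-- The plan that steers `x` towards the equilibrium `(xe, ue)` with the terminal controller
alone, and whose terminal sets are centred at `xe`. -/
def terminalPlan (ν : Network ι n m q r p) (α : ι → ℝ) (mu : ι → ι → ℝ) (x xe : ν.StateIdx → ℝ)
    (ue : ν.InputIdx → ℝ) : ν.Plan where
  x t := xe + ν.bigAcl ^ t *ᵥ (x - xe)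
  u t := ue + ν.diag ν.K *ᵥ (ν.bigAcl ^ t *ᵥ (x - xe))
  xe := xe
  ue := ue
  α := α
  c := xe
  d := ue - ν.diag ν.K *ᵥ xe
  b := 0
  mu := mu

lemma bigAcl_pow_succ_mulVec (t : ℕ) (e : ν.StateIdx → ℝ) :
    ν.bigAcl ^ (t + 1) *ᵥ e = ν.bigAcl *ᵥ (ν.bigAcl ^ t *ᵥ e) := by
  rw [pow_succ', Matrix.mulVec_mulVec]

lemma quad_bigAcl_pow_le (hlmi : ∀ i ∈ ν.M, ν.LocalLMI i) (e : ν.StateIdx → ℝ) (t : ℕ) :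
    quad (ν.diag ν.P) (ν.bigAcl ^ t *ᵥ e) ≤ quad (ν.diag ν.P) e := by
  induction t with
  | zero => simp
  | succ t ih => exact (bigAcl_pow_succ_mulVec t e ▸ ν.quad_bigAcl_le hlmi _).trans ih

lemma UniformTerminalSets.feasible_terminalPlan (h : ν.UniformTerminalSets δ α mu)
    (hlmi : ∀ i ∈ ν.M, ν.LocalLMI i) (hT : 1 ≤ T) (hadm : ν.AdmissibleTarget xe ue)
    (hx : quad (ν.diag ν.P) (x - xe) ≤ δ) :
    ν.Feasible dominated T x (ν.terminalPlan α mu x xe ue) := by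
  have hp := h.params xe ue hadm
  have hquad : ∀ t, quad (ν.diag ν.P) (ν.bigAcl ^ t *ᵥ (x - xe)) ≤ δ := fun t =>
    (quad_bigAcl_pow_le hlmi (x - xe) t).trans hx
  have hmem : ∀ t, ∀ i ∈ ν.M, ν.U i *ᵥ (xe + ν.bigAcl ^ t *ᵥ (x - xe))
      ∈ ellipsoid _ (ν.P i) (ν.U i *ᵥ xe) (α i) := fun t i hi => by
    change quad _ _ ≤ _
    rw [Matrix.mulVec_add, add_sub_cancel_left]
    exact h.mem_ellipsoid _ (hquad t) i hi
  refine ⟨by simp [terminalPlan], fun t _ => ?_, fun t _ i hi => hp.mem_X hi (hmem t i hi),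
    fun t _ i hi => ?_, hadm.1, fun i hi => (hadm.2 i hi).1, fun i hi => ?_,
    fun i hi => (hadm.2 i hi).2, hp.size, fun i hi => ?_, hp.invariance, hp.term_state,
    hp.term_input⟩
  · have hxe := ν.next_iff.mp hadm.1
    dsimp only [terminalPlan]
    rw [next_iff, bigAcl_pow_succ_mulVec, bigAcl_mulVec, Matrix.mulVec_add, Matrix.mulVec_add]
    nth_rewrite 1 [hxe]
    abel
  · dsimp only [terminalPlan]
    convert hp.mem_Uset hi (hmem t i hi) using 1
    simp only [Matrix.mulVec_add, Matrix.mulVec_sub, ν.V_diag_mulVec hi]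
    abel
  · dsimp only [terminalPlan]
    rw [Matrix.mulVec_sub, ν.V_diag_mulVec hi, add_sub_cancel]
  · obtain ⟨T, rfl⟩ := Nat.exists_eq_add_of_le' hT
    dsimp only [terminalPlan]
    rw [mem_dominated_iff_sub_mem, Matrix.mulVec_add, add_sub_cancel_left,
      bigAcl_pow_succ_mulVec]
    exact h.bigAcl_mem_dominated _ (hquad T) i hi

lemma cost_terminalPlan_le (hlmi : ∀ i ∈ ν.M, ν.LocalLMI i) (xr : ν.StateIdx → ℝ) :
    ν.cost T xr (ν.terminalPlan α mu x xe ue)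
      ≤ quad (ν.diag ν.P) (x - xe) + quad (ν.diag ν.S) (xe - xr) := by
  rw [cost_eq_quad_diag]
  simp only [terminalPlan, add_sub_cancel_left]
  refine add_le_add_left ?_ _
  induction T with
  | zero => simp
  | succ T ih =>
    have hlast := ν.stageCost_add_quad_bigAcl_le hlmi (ν.bigAcl ^ T *ᵥ (x - xe))
    rw [Finset.sum_range_succ, bigAcl_pow_succ_mulVec]
    linarith

end TerminalPlan

end Network

lemma tendsto_zero_of_decrease {v a : ℕ → ℝ} (hv : ∀ t, 0 ≤ v t) (ha : ∀ t, 0 ≤ a t)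
    (h : ∀ t, v (t + 1) + a t ≤ v t) : Tendsto a atTop (𝓝 0) := by
  have hsum : ∀ N, ∑ t ∈ Finset.range N, a t + v N ≤ v 0 := fun N => by
    induction N with
    | zero => simp
    | succ N ih => rw [Finset.sum_range_succ]; linarith [h N]
  exact (summable_of_sum_range_le ha fun N => by linarith [hsum N, hv N]).tendsto_atTop_zero

namespace Network

variable {ι : Type*} [DecidableEq ι]

section Lyapunov

variable {n m q r : ι → ℕ} {p : ℕ} {ν : Network ι n m q r p} {Xf : TerminalConstraint} {T : ℕ}
  {xr : ν.StateIdx → ℝ} {E : Set (ν.StateIdx → ℝ)} {δ : ℝ}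

/-- Every admissible equilibrium can be tracked from a neighbourhood whose size `δ` does not depend
on the equilibrium, at no more than the cost of the terminal controller. -/
def LocallyTrackable (ν : Network ι n m q r p) (Xf : TerminalConstraint) (T : ℕ)
    (xr : ν.StateIdx → ℝ) (δ : ℝ) : Prop :=
  ∀ xe ue, ν.AdmissibleTarget xe ue → ∀ x, quad (ν.diag ν.P) (x - xe) ≤ δ →
    ∃ z, ν.Feasible Xf T x z ∧
      ν.cost T xr z ≤ quad (ν.diag ν.P) (x - xe) + quad (ν.diag ν.S) (xe - xr)

/-- The optimal cost is a Lyapunov function of the closed loop on `E`: the predicted next state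
stays in `E` and admits a plan that is cheaper by the distance to the artificial equilibrium. -/
def CostDecreasesOn (ν : Network ι n m q r p) (Xf : TerminalConstraint) (T : ℕ)
    (xr : ν.StateIdx → ℝ) (E : Set (ν.StateIdx → ℝ)) : Prop :=
  ∀ x ∈ E, ∀ z, ν.Optimal Xf T xr x z → z.x 1 ∈ E ∧ ∃ z', ν.Feasible Xf T (z.x 1) z' ∧
    ν.cost T xr z' + quad (ν.diag ν.Q) (x - z.xe) ≤ ν.cost T xr z

lemma LocallyTrackable.mono {Xf' : TerminalConstraint} (h : ν.LocallyTrackable Xf T xr δ)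
    (hXf : ∀ x z, ν.Feasible Xf T x z → ν.Feasible Xf' T x z) : ν.LocallyTrackable Xf' T xr δ :=
  fun xe ue hadm x hx => (h xe ue hadm x hx).imp fun z hz => ⟨hXf x z hz.1, hz.2⟩

section Plan

variable {x : ν.StateIdx → ℝ} {z : ν.Plan}

lemma Feasible.x_one_eq (h : ν.Feasible Xf T x z) (hT : 1 ≤ T) {y : ν.StateIdx → ℝ}
    (hy : ν.Next x (z.u 0) y) : z.x 1 = y := by
  have hnext := ν.next_iff.mp (h.dyn 0 hT)
  rw [h.init, ← ν.next_iff.mp hy] at hnext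
  exact hnext

lemma Feasible.quad_add_quad_offset_le_cost (h : ν.Feasible Xf T x z) (hT : 1 ≤ T) :
    quad (ν.diag ν.Q) (x - z.xe) + quad (ν.diag ν.S) (z.xe - xr) ≤ ν.cost T xr z :=
  h.init ▸ ν.quad_initial_add_quad_offset_le_cost xr z hT

lemma eventually_quad_sub_le (hδ : 0 < δ) :
    ∀ᶠ x in 𝓝 xr, quad (ν.diag ν.P) (x - xr) ≤ δ := by
  have hcont : Continuous fun x => quad (ν.diag ν.P) (x - xr) :=
    (continuous_quad _).comp (continuous_sub_right xr)
  refine (hcont.tendsto' xr 0 ?_).eventually_le_const hδ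
  rw [sub_self, quad_zero]

lemma LocallyTrackable.cost_le (h : ν.LocallyTrackable Xf T xr δ) (hz : ν.Optimal Xf T xr x z)
    {ur : ν.InputIdx → ℝ} (htarget : ν.AdmissibleTarget xr ur)
    (hx : quad (ν.diag ν.P) (x - xr) ≤ δ) : ν.cost T xr z ≤ quad (ν.diag ν.P) (x - xr) := by
  obtain ⟨z', hz', hcost⟩ := h xr ur htarget x hx
  rw [sub_self, quad_zero, add_zero] at hcost
  exact (hz.2 z' hz').trans hcost

lemma quad_sub_lineMap_le {κ D : ℝ} (hκ : ∀ y, quad (ν.diag ν.P) y ≤ κ * quad (ν.diag ν.S) y)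
    (x xe : ν.StateIdx → ℝ) (β : ℝ) (hD : quad (ν.diag ν.S) (xe - xr) = D) :
    quad (ν.diag ν.P) (x - AffineMap.lineMap xe xr β)
      ≤ 2 * quad (ν.diag ν.P) (x - xe) + 2 * (β ^ 2 * (κ * D)) := by
  have hsplit : x - AffineMap.lineMap xe xr β = (x - xe) + β • (xe - xr) := by
    rw [AffineMap.lineMap_apply_module]
    module
  rw [hsplit, ← hD]
  have hle := quad_add_le ν.posDef_diag_P (x - xe) (β • (xe - xr))
  rw [quad_smul] at hle
  linarith [mul_le_mul_of_nonneg_left (hκ (xe - xr)) (sq_nonneg β)]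

-- Tracking the equilibrium a fraction `β` closer to the target lowers the offset cost to first
-- order in `β` but raises the tracking cost only to second order, so an optimal plan whose
-- tracking cost is small cannot have a large offset.
lemma LocallyTrackable.mul_quad_offset_le (h : ν.LocallyTrackable Xf T xr δ) (hT : 1 ≤ T)
    (hz : ν.Optimal Xf T xr x z) {ur : ν.InputIdx → ℝ} (htarget : ν.AdmissibleTarget xr ur)
    {κ β : ℝ} (hκ : ∀ y, quad (ν.diag ν.P) y ≤ κ * quad (ν.diag ν.S) y) (hκ0 : 0 < κ)
    (hβ : 0 < β) (hβκ : (1 + 2 * κ) * β ≤ 1)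
    (hβδ : β * (4 * κ * quad (ν.diag ν.S) (z.xe - xr)) ≤ δ)
    (hx : 4 * quad (ν.diag ν.P) (x - z.xe) ≤ δ) :
    β * quad (ν.diag ν.S) (z.xe - xr) ≤ 2 * quad (ν.diag ν.P) (x - z.xe) := by
  set D := quad (ν.diag ν.S) (z.xe - xr) with hD
  have hD0 : 0 ≤ D := quad_nonneg ν.posDef_diag_S _
  have hβ1 : β ≤ 1 := by nlinarith
  have hP := quad_sub_lineMap_le hκ x z.xe β hD.symm
  have hnear : 2 * (β ^ 2 * (κ * D)) ≤ δ / 2 := by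
    have : β ^ 2 * (κ * D) ≤ β * (κ * D) :=
      mul_le_mul_of_nonneg_right (by nlinarith) (by positivity)
    linarith
  obtain ⟨z', hz', hcost⟩ := h _ _ (hz.1.admissibleTarget.lineMap htarget ⟨hβ.le, hβ1⟩) x
    (by linarith)
  have hoffset : AffineMap.lineMap z.xe xr β - xr = (1 - β) • (z.xe - xr) := by
    rw [AffineMap.lineMap_apply_module]
    module
  rw [hoffset, quad_smul, ← hD] at hcost
  have hopt : D ≤ 2 * quad (ν.diag ν.P) (x - z.xe) + 2 * (β ^ 2 * (κ * D)) + (1 - β) ^ 2 * D := by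
    linarith [hz.2 z' hz', hz.1.quad_add_quad_offset_le_cost (xr := xr) hT,
      quad_nonneg ν.posDef_diag_Q (x - z.xe)]
  nlinarith [mul_le_mul_of_nonneg_right (mul_le_mul_of_nonneg_left hβκ hβ.le) hD0]

end Plan

section ClosedLoop

variable {x : ℕ → ν.StateIdx → ℝ} {u : ℕ → ν.InputIdx → ℝ}

lemma CostDecreasesOn.mem_of_mpcStep (h : ν.CostDecreasesOn Xf T xr E) (hT : 1 ≤ T)
    {x : ν.StateIdx → ℝ} (hx : x ∈ E) {u : ν.InputIdx → ℝ} {y : ν.StateIdx → ℝ}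
    (hstep : ν.MPCStep Xf T xr x u y) : y ∈ E := by
  obtain ⟨⟨z, hz, rfl⟩, hy⟩ := hstep
  exact hz.1.x_one_eq hT hy ▸ (h x hx z hz).1

lemma ClosedLoop.constraints (hcl : ν.ClosedLoop Xf T xr x u) (hT : 1 ≤ T) (t : ℕ) {i : ι}
    (hi : i ∈ ν.M) : ν.U i *ᵥ x t ∈ ν.X i ∧ ν.V i *ᵥ u t ∈ ν.Uset i := by
  obtain ⟨⟨z, hz, hu⟩, -⟩ := hcl t
  rw [← hz.1.init, ← hu]
  exact ⟨hz.1.state 0 (Nat.zero_le _) i hi, hz.1.input 0 hT i hi⟩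

lemma CostDecreasesOn.exists_plans (h : ν.CostDecreasesOn Xf T xr E) (hT : 1 ≤ T)
    (hcl : ν.ClosedLoop Xf T xr x u) (h0 : x 0 ∈ E) :
    ∃ z : ℕ → ν.Plan, (∀ t, ν.Optimal Xf T xr (x t) (z t)) ∧
      ∀ t, ν.cost T xr (z (t + 1)) + quad (ν.diag ν.Q) (x t - (z t).xe) ≤ ν.cost T xr (z t) := by
  have hmem : ∀ t, x t ∈ E := fun t => by
    induction t with
    | zero => exact h0
    | succ t ih => exact h.mem_of_mpcStep hT ih (hcl t)
  choose z hz hu using fun t => (hcl t).1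
  refine ⟨z, hz, fun t => ?_⟩
  obtain ⟨-, z', hz', hcost⟩ := h _ (hmem t) (z t) (hz t)
  rw [(hz t).1.x_one_eq hT (hu t ▸ (hcl t).2)] at hz'
  linarith [(hz (t + 1)).2 z' hz']

lemma antitone_cost {z : ℕ → ν.Plan} (hdec : ∀ t, ν.cost T xr (z (t + 1))
      + quad (ν.diag ν.Q) (x t - (z t).xe) ≤ ν.cost T xr (z t)) :
    Antitone fun t => ν.cost T xr (z t) :=
  antitone_nat_of_succ_le fun t => by
    linarith [hdec t, quad_nonneg ν.posDef_diag_Q (x t - (z t).xe)]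

end ClosedLoop

lemma CostDecreasesOn.stable (hstep : ν.CostDecreasesOn Xf T xr E) (hT : 1 ≤ T)
    {ur : ν.InputIdx → ℝ} (htarget : ν.AdmissibleTarget xr ur)
    (htrack : ν.LocallyTrackable Xf T xr δ) (hδ : 0 < δ) {ε : ℝ} (hε : 0 < ε) :
    ∃ η > 0, ∀ x u, ν.ClosedLoop Xf T xr x u → x 0 ∈ E → dist (x 0) xr < η →
      ∀ t, dist (x t) xr < ε := by
  obtain ⟨v, ⟨hQ, hS⟩, hv⟩ :=
    ((eventually_norm_le_of_quad_le ν.posDef_diag_Q (by positivity : 0 < ε / 3)).and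
      (eventually_norm_le_of_quad_le ν.posDef_diag_S (by positivity : 0 < ε / 3)) |>.and
        self_mem_nhdsWithin).exists
  obtain ⟨η, hη, hnear⟩ := Metric.eventually_nhds_iff.mp
    (eventually_quad_sub_le (xr := xr) (lt_min hδ hv))
  refine ⟨η, hη, fun x u hcl h0 hx t => ?_⟩
  obtain ⟨z, hz, hdec⟩ := hstep.exists_plans hT hcl h0
  have hx0 := le_min_iff.mp (hnear hx)
  have hcost : ν.cost T xr (z t) ≤ v :=
    (antitone_cost hdec (Nat.zero_le t)).trans
      ((htrack.cost_le (hz 0) htarget hx0.1).trans hx0.2)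
  have hlow := (hz t).1.quad_add_quad_offset_le_cost (xr := xr) hT
  have htracking := hQ (x t - (z t).xe)
    (by linarith [quad_nonneg ν.posDef_diag_S ((z t).xe - xr)])
  have hoffset := hS ((z t).xe - xr) (by linarith [quad_nonneg ν.posDef_diag_Q (x t - (z t).xe)])
  have htriangle := norm_sub_le_norm_sub_add_norm_sub (x t) (z t).xe xr
  rw [dist_eq_norm]
  linarith

lemma LocallyTrackable.tendsto_offset (htrack : ν.LocallyTrackable Xf T xr δ) (hδ : 0 < δ)
    (hT : 1 ≤ T) {ur : ν.InputIdx → ℝ} (htarget : ν.AdmissibleTarget xr ur)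
    {x : ℕ → ν.StateIdx → ℝ} {z : ℕ → ν.Plan} (hz : ∀ t, ν.Optimal Xf T xr (x t) (z t)) {v : ℝ}
    (hv : ∀ t, ν.cost T xr (z t) ≤ v) (hx : Tendsto (fun t => x t - (z t).xe) atTop (𝓝 0)) :
    Tendsto (fun t => (z t).xe - xr) atTop (𝓝 0) := by
  obtain ⟨κ, hκ0, hκ⟩ := exists_quad_le_mul_quad ν.posDef_diag_S (ν.diag ν.P)
  have hS : ∀ t, quad (ν.diag ν.S) ((z t).xe - xr) ≤ v := fun t => by
    linarith [hv t, (hz t).1.quad_add_quad_offset_le_cost (xr := xr) hT,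
      quad_nonneg ν.posDef_diag_Q (x t - (z t).xe)]
  obtain ⟨β, ⟨hβκ, hβδ⟩, hβ : 0 < β⟩ := ((eventually_mul_le (1 + 2 * κ) one_pos).and
    (eventually_mul_le (4 * κ * v) hδ) |>.and self_mem_nhdsWithin).exists
  have hP := (tendsto_quad_zero_iff ν.posDef_diag_P).mpr hx
  refine (tendsto_quad_zero_iff ν.posDef_diag_S).mp (squeeze_zero'
    (Eventually.of_forall fun t => quad_nonneg ν.posDef_diag_S _) ?_
    (by simpa only [mul_zero] using hP.const_mul (2 / β)))
  filter_upwards [hP.eventually_le_const (by positivity : 0 < δ / 4)] with t ht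
  have hβS : β * (4 * κ * quad (ν.diag ν.S) ((z t).xe - xr)) ≤ δ := by
    refine le_trans ?_ hβδ
    rw [mul_comm _ β]
    gcongr
    exact hS t
  have hoffset := htrack.mul_quad_offset_le hT (hz t) htarget hκ hκ0 hβ hβκ hβS
    (by linarith)
  rw [div_mul_eq_mul_div, le_div_iff₀ hβ, mul_comm]
  exact hoffset

lemma CostDecreasesOn.attractive (hstep : ν.CostDecreasesOn Xf T xr E) (hT : 1 ≤ T)
    {ur : ν.InputIdx → ℝ} (htarget : ν.AdmissibleTarget xr ur)
    (htrack : ν.LocallyTrackable Xf T xr δ) (hδ : 0 < δ) {x : ℕ → ν.StateIdx → ℝ}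
    {u : ℕ → ν.InputIdx → ℝ} (hcl : ν.ClosedLoop Xf T xr x u) (h0 : x 0 ∈ E) :
    Tendsto x atTop (𝓝 xr) := by
  obtain ⟨z, hz, hdec⟩ := hstep.exists_plans hT hcl h0
  have hQ0 : ∀ t, 0 ≤ quad (ν.diag ν.Q) (x t - (z t).xe) := fun t => quad_nonneg ν.posDef_diag_Q _
  have hcost0 : ∀ t, 0 ≤ ν.cost T xr (z t) := fun t => by
    linarith [(hz t).1.quad_add_quad_offset_le_cost (xr := xr) hT, hQ0 t,
      quad_nonneg ν.posDef_diag_S ((z t).xe - xr)]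
  have htracking : Tendsto (fun t => x t - (z t).xe) atTop (𝓝 0) :=
    (tendsto_quad_zero_iff ν.posDef_diag_Q).mp (tendsto_zero_of_decrease hcost0 hQ0 hdec)
  have hoffset := htrack.tendsto_offset hδ hT htarget hz
    (fun t => antitone_cost hdec (Nat.zero_le t)) htracking
  rw [← tendsto_sub_nhds_zero_iff]
  simpa only [sub_add_sub_cancel, add_zero] using htracking.add hoffset

lemma CostDecreasesOn.asymptoticallyStable (hstep : ν.CostDecreasesOn Xf T xr E) (hT : 1 ≤ T)
    {ur : ν.InputIdx → ℝ} (htarget : ν.AdmissibleTarget xr ur)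
    (htrack : ν.LocallyTrackable Xf T xr δ) (hδ : 0 < δ) (hnhds : E ∈ 𝓝 xr)
    (hfeas : E ⊆ ν.feasibleStates Xf T)
    (hsolv : (∀ i ∈ ν.M, Bornology.IsBounded (ν.X i) ∧ Bornology.IsBounded (ν.Uset i)) →
      ∀ x ∈ E, ∃ z, ν.Optimal Xf T xr x z) :
    ν.AsymptoticallyStable Xf T xr E where
  nhds := hnhds
  feasible := hfeas
  solvable := hsolv
  invariant _ hx _ _ hxy := hstep.mem_of_mpcStep hT hx hxy
  constraints _ _ hcl _ t _ hi := hcl.constraints hT t hi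
  stable _ hε := hstep.stable hT htarget htrack hδ hε
  attractive _ _ hcl h0 := hstep.attractive hT htarget htrack hδ hcl h0

end Lyapunov

end Network

lemma isCompact_inter_forall_abs_le {κ : Type*} {s : Set (κ → ℝ)} (hs : IsClosed s)
    (R : κ → ℝ) : IsCompact (s ∩ {y | ∀ v, |y v| ≤ R v}) := by
  have hbox : IsCompact {y : κ → ℝ | ∀ v, |y v| ≤ R v} := by
    simpa only [Set.mem_Icc, ← abs_le] using
      isCompact_pi_infinite fun v => isCompact_Icc (a := -R v) (b := R v)
  exact hbox.inter_left hs

lemma exists_abs_apply_le_of_isBounded {a : Type*} [Finite a] {S : Set (a → ℝ)}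
    (hS : Bornology.IsBounded S) : ∃ R, ∀ y ∈ S, ∀ k, |y k| ≤ R := by
  have := Fintype.ofFinite a
  exact hS.exists_norm_le.imp fun _ hR y hy k => (norm_le_pi_norm y k).trans (hR y hy)

lemma isBounded_mulVec_image {a b : Type*} [Finite a] [Fintype b] (K : Matrix a b ℝ)
    {S : Set (b → ℝ)} (hS : Bornology.IsBounded S) :
    Bornology.IsBounded ((fun v => K *ᵥ v) '' S) :=
  have := Fintype.ofFinite a
  (LinearMap.toContinuousLinearMap K.mulVecLin).lipschitz.isBounded_image hS

lemma mul_norm_le_diam_mul_sqrt_quad {a : Type*} [Fintype a] {P : Matrix a a ℝ} (hP : P.PosDef)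
    {S : Set (a → ℝ)} (hS : Bornology.IsBounded S) {c : a → ℝ} {α : ℝ} (hα : 0 ≤ α)
    (hsub : {x | quad P (x - c) ≤ α ^ 2} ⊆ S) (v : a → ℝ) :
    α * ‖v‖ ≤ Metric.diam S * √(quad P v) := by
  obtain rfl | hv := eq_or_ne v 0
  · simp [quad_zero]
  have hw : 0 < √(quad P v) := Real.sqrt_pos.mpr (quad_pos hP hv)
  have hmem : c + (α / √(quad P v)) • v ∈ S := hsub <| by
    change quad P _ ≤ α ^ 2
    rw [add_sub_cancel_left, quad_smul, div_pow, Real.sq_sqrt (quad_nonneg hP v),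
      div_mul_cancel₀ _ (quad_pos hP hv).ne']
  have hc : c ∈ S := hsub <| by
    change quad P _ ≤ α ^ 2
    rw [sub_self, quad_zero]
    positivity
  have hdist := Metric.dist_le_diam_of_mem hS hmem hc
  rwa [dist_eq_norm, add_sub_cancel_left, norm_smul, Real.norm_of_nonneg (by positivity),
    div_mul_eq_mul_div, div_le_iff₀ hw] at hdist

lemma isClosed_polytope {a b : Type*} [Fintype b] (G : Matrix a b ℝ) (g : a → ℝ) :
    IsClosed {x | G *ᵥ x ≤ g} :=
  isClosed_le (by fun_prop) continuous_const

namespace Network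

variable {ι : Type*} [DecidableEq ι]

section ClosedTerminalConstraint

/-- Membership in the terminal set is a closed condition on the point, the centre and the size. -/
def TerminalConstraint.Closed (Xf : TerminalConstraint) : Prop :=
  ∀ (d : ℕ) (P : Matrix (Fin d) (Fin d) ℝ),
    IsClosed {s : (Fin d → ℝ) × (Fin d → ℝ) × ℝ | s.1 ∈ Xf d P s.2.1 s.2.2}

lemma closed_ellipsoid : TerminalConstraint.Closed ellipsoid := fun _ P =>
  isClosed_le ((continuous_quad P).comp (by fun_prop)) (by fun_prop)

-- The smallest admissible slack is `|x - c|`, which eliminates the existential quantifier.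
lemma mem_dominated_iff {d : ℕ} {P : Matrix (Fin d) (Fin d) ℝ} {c x : Fin d → ℝ} {α : ℝ} :
    x ∈ dominated d P c α ↔ (∀ j, |x j - c j| + α * rowAbs P⁻¹ j ≤ 2 * α * P⁻¹ j j) ∧
      ∑ j, |x j - c j| ≤ α := by
  refine ⟨fun ⟨bb, hdom, hsum, hbb⟩ => ?_, fun ⟨hdom, hsum⟩ =>
    ⟨fun j => |x j - c j|, hdom, hsum, fun j => abs_le.mp le_rfl⟩⟩
  have hle : ∀ j, |x j - c j| ≤ bb j := fun j => abs_le.mpr (hbb j)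
  exact ⟨fun j => (add_le_add_left (hle j) _).trans (hdom j),
    (Finset.sum_le_sum fun j _ => hle j).trans hsum⟩

lemma closed_dominated : TerminalConstraint.Closed dominated := fun d P => by
  simp only [mem_dominated_iff, Set.ofPred_and, Set.ofPred_forall]
  exact (isClosed_iInter fun j => isClosed_le (by fun_prop) (by fun_prop)).inter
    (isClosed_le (by fun_prop) (by fun_prop))

end ClosedTerminalConstraint

section PlanVar

variable {n m q r : ι → ℕ} {p : ℕ} (ν : Network ι n m q r p)

/-- The scalar decision variables of the optimal control problem, so that plans become points of
the product space `ν.PlanVar → ℝ`. -/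
inductive PlanVar
  | x (t : ℕ) (s : ν.StateIdx)
  | u (t : ℕ) (s : ν.InputIdx)
  | xe (s : ν.StateIdx)
  | ue (s : ν.InputIdx)
  | α (i : ι)
  | c (s : ν.StateIdx)
  | d (s : ν.InputIdx)
  | b (s : ν.StateIdx)
  | mu (i j : ι)

variable {ν} {T : ℕ}

/-- The plan with the given values of the decision variables. -/
abbrev toPlan (y : ν.PlanVar → ℝ) : ν.Plan where
  x t s := y (.x t s)
  u t s := y (.u t s)
  xe s := y (.xe s)
  ue s := y (.ue s)
  α i := y (.α i)
  c s := y (.c s)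
  d s := y (.d s)
  b s := y (.b s)
  mu i j := y (.mu i j)

/-- The values of the decision variables of a plan, with those that are irrelevant for the horizon
`T` set to zero. -/
def truncate (T : ℕ) (z : ν.Plan) : ν.PlanVar → ℝ
  | .x t s => if t ≤ T then z.x t s else 0
  | .u t s => if t < T then z.u t s else 0
  | .xe s => z.xe s
  | .ue s => z.ue s
  | .α i => if i ∈ ν.M then z.α i else 0
  | .c s => z.c s
  | .d s => z.d s
  | .b s => z.b s
  | .mu i j => if i ∈ ν.M ∧ j ∈ ν.N i then z.mu i j else 0

lemma cost_truncate (xr : ν.StateIdx → ℝ) (z : ν.Plan) :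
    ν.cost T xr (toPlan (truncate T z)) = ν.cost T xr z := by
  simp only [cost_eq_quad_diag, toPlan, truncate, le_refl, if_true]
  congr 2
  refine Finset.sum_congr rfl fun t ht => ?_
  have ht := Finset.mem_range.mp ht
  simp only [if_pos ht.le, if_pos ht]

lemma invarianceConstraint_iff {i : ι} {α : ι → ℝ} {c : ν.StateIdx → ℝ} {d : ν.InputIdx → ℝ}
    {b : ν.StateIdx → ℝ} {mu : ι → ι → ℝ} : ν.InvarianceConstraint i α c d b mu ↔
    (∀ k, α i * rowAbs (ν.P i)⁻¹ k + ∑ l : ν.NbrIdx i, |ν.Acl i k l| * α l.1 + (ν.U i *ᵥ b) k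
      ≤ 2 * α i * (ν.P i)⁻¹ k k) ∧
    (∀ k, |(ν.Acl i *ᵥ (ν.W i *ᵥ c) + ν.B i *ᵥ (ν.V i *ᵥ d) - ν.U i *ᵥ c) k| ≤ (ν.U i *ᵥ b) k) ∧
    (∀ k : ν.NbrIdx i, ∑ j ∈ ν.N i, mu i j * rowAbs (ν.Pij i j) k + ∑ l, |ν.Acl i l k| * α k.1
      ≤ 2 * ∑ j ∈ ν.N i, mu i j * ν.Pij i j k k) ∧
    ∑ k, (ν.U i *ᵥ b) k ≤ α i - ∑ j ∈ ν.N i, mu i j ∧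
    ∀ j ∈ ν.N i, 0 ≤ mu i j := by
  simp only [InvarianceConstraint, αN, Matrix.transpose_apply, Matrix.mul_diagonal,
    Matrix.map_apply]

lemma InvarianceConstraint.congr {i : ι} (hi : i ∈ ν.M) {α α' : ι → ℝ} {c : ν.StateIdx → ℝ}
    {d : ν.InputIdx → ℝ} {b : ν.StateIdx → ℝ} {mu mu' : ι → ι → ℝ}
    (h : ν.InvarianceConstraint i α c d b mu) (hα : ∀ j ∈ ν.N i, α' j = α j)
    (hmu : ∀ j ∈ ν.N i, mu' i j = mu i j) : ν.InvarianceConstraint i α' c d b mu' := by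
  have hsum : ∀ f : ι → ℝ, ∑ j ∈ ν.N i, mu' i j * f j = ∑ j ∈ ν.N i, mu i j * f j := fun f =>
    Finset.sum_congr rfl fun j hj => by rw [hmu j hj]
  have hαN : ∀ l : ν.NbrIdx i, α' l.1 = α l.1 := fun l => hα l.1 l.1.2
  rw [invarianceConstraint_iff] at h ⊢
  simp only [hsum, hαN, hα i (ν.self_mem_N i hi), Finset.sum_congr rfl hmu]
  exact ⟨h.1, h.2.1, h.2.2.1, h.2.2.2.1, fun j hj => hmu j hj ▸ h.2.2.2.2 j hj⟩

lemma Feasible.toPlan_truncate {Xf : TerminalConstraint} {x₀ : ν.StateIdx → ℝ} {z : ν.Plan}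
    (h : ν.Feasible Xf T x₀ z) : ν.Feasible Xf T x₀ (toPlan (truncate T z)) where
  init := by simpa only [toPlan, truncate, Nat.zero_le, if_true] using h.init
  dyn t ht := by
    simpa only [toPlan, truncate, if_pos ht.le, if_pos ht, if_pos (Nat.succ_le_of_lt ht)]
      using h.dyn t ht
  state t ht i hi := by simpa only [toPlan, truncate, if_pos ht] using h.state t ht i hi
  input t ht i hi := by simpa only [toPlan, truncate, if_pos ht] using h.input t ht i hi
  eq_dyn := h.eq_dyn
  eq_state := h.eq_state
  eq_ctrl := h.eq_ctrl
  eq_input := h.eq_input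
  size i hi := by simpa only [toPlan, truncate, if_pos hi] using h.size i hi
  terminal i hi := by
    simpa only [toPlan, truncate, if_pos hi, if_pos le_rfl] using h.terminal i hi
  invariance i hi := (h.invariance i hi).congr hi
    (fun j hj => by simp only [truncate, if_pos (ν.N_subset i hi hj)])
    (fun j hj => by simp only [truncate, if_pos (And.intro hi hj)])
  term_state i hi := by simpa only [toPlan, truncate, if_pos hi] using h.term_state i hi
  term_input i hi := by simpa only [toPlan, truncate, if_pos hi] using h.term_input i hi

end PlanVar

section IsClosed

variable {n m q r : ι → ℕ} {p : ℕ} {ν : Network ι n m q r p}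

lemma continuous_cost_toPlan (T : ℕ) (xr : ν.StateIdx → ℝ) :
    Continuous fun y : ν.PlanVar → ℝ => ν.cost T xr (toPlan y) := by
  simp only [cost_eq_quad_diag, toPlan]
  have hstate := fun X => continuous_quad (ν.diag (a := n) X)
  have hinput := fun X => continuous_quad (ν.diag (a := m) X)
  fun_prop

lemma isClosed_next {Y : Type*} [TopologicalSpace Y] {x x' : Y → ν.StateIdx → ℝ}
    {u : Y → ν.InputIdx → ℝ} (hx : Continuous x) (hu : Continuous u) (hx' : Continuous x') :
    IsClosed {y | ν.Next (x y) (u y) (x' y)} := by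
  simp only [Next, Set.ofPred_forall]
  exact isClosed_iInter fun i => isClosed_iInter fun _ => isClosed_eq (by fun_prop) (by fun_prop)

lemma isClosed_X (i : ι) : IsClosed (ν.X i) := isClosed_polytope (ν.G i) (ν.g i)

lemma isClosed_Uset (i : ι) : IsClosed (ν.Uset i) := isClosed_polytope (ν.H i) (ν.h i)

lemma isClosed_invarianceConstraint (i : ι) :
    IsClosed {y : ν.PlanVar → ℝ | ν.InvarianceConstraint i (toPlan y).α (toPlan y).c (toPlan y).d
      (toPlan y).b (toPlan y).mu} := by
  simp only [invarianceConstraint_iff, Set.ofPred_and, Set.ofPred_forall]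
  refine (isClosed_iInter fun k => isClosed_le ?_ ?_).inter <|
    (isClosed_iInter fun k => isClosed_le ?_ ?_).inter <|
    (isClosed_iInter fun k => isClosed_le ?_ ?_).inter <|
    (isClosed_le ?_ ?_).inter <|
    isClosed_iInter fun j => isClosed_iInter fun _ => isClosed_le ?_ ?_
  all_goals fun_prop

lemma isClosed_feasible_toPlan {Xf : TerminalConstraint} (hXf : Xf.Closed) (T : ℕ)
    (x₀ : ν.StateIdx → ℝ) : IsClosed {y : ν.PlanVar → ℝ | ν.Feasible Xf T x₀ (toPlan y)} := by
  refine isClosed_of_closure_subset fun y hy => ?_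
  have extend : ∀ {C : (ν.PlanVar → ℝ) → Prop}, IsClosed {y | C y} →
      (∀ y, ν.Feasible Xf T x₀ (toPlan y) → C y) → C y :=
    fun hC hsub => closure_minimal hsub hC hy
  have hlamX := fun i hi => (ν.isClosed_X i).smul_of_ne_zero (ν.lam_mem i hi).1.ne'
  have hlamU := fun i hi => (ν.isClosed_Uset i).smul_of_ne_zero (ν.lam_mem i hi).1.ne'
  exact
  { init := extend (isClosed_eq (by fun_prop) continuous_const) fun _ h => h.init
    dyn t ht := extend (isClosed_next (by fun_prop) (by fun_prop)
      (by fun_prop)) fun _ h => h.dyn t ht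
    state t ht i hi := extend ((ν.isClosed_X i).preimage (by fun_prop))
      fun _ h => h.state t ht i hi
    input t ht i hi := extend ((ν.isClosed_Uset i).preimage (by fun_prop))
      fun _ h => h.input t ht i hi
    eq_dyn := extend (isClosed_next (by fun_prop) (by fun_prop)
      (by fun_prop)) fun _ h => h.eq_dyn
    eq_state i hi := extend ((hlamX i hi).preimage (by fun_prop))
      fun _ h => h.eq_state i hi
    eq_ctrl i hi := extend (isClosed_eq (by fun_prop) (by fun_prop))
      fun _ h => h.eq_ctrl i hi
    eq_input i hi := extend ((hlamU i hi).preimage (by fun_prop))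
      fun _ h => h.eq_input i hi
    size i hi := extend (isClosed_le continuous_const (by fun_prop))
      fun _ h => h.size i hi
    terminal i hi := extend ((hXf (n i) (ν.P i)).preimage
        (f := fun y => (ν.U i *ᵥ (toPlan y).x T, ν.U i *ᵥ (toPlan y).c, (toPlan y).α i))
        (by fun_prop)) fun _ h => h.terminal i hi
    invariance i hi := extend (isClosed_invarianceConstraint i) fun _ h => h.invariance i hi
    term_state i hi k := extend (isClosed_le (by fun_prop) continuous_const)
      fun _ h => h.term_state i hi k
    term_input i hi l := extend (isClosed_le (by fun_prop) continuous_const)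
      fun _ h => h.term_input i hi l }

end IsClosed

end Network

namespace Network

variable {ι : Type*} [DecidableEq ι]

section Bounds

variable {n m q r : ι → ℕ} {p : ℕ} {ν : Network ι n m q r p} {α : ι → ℝ} {c : ν.StateIdx → ℝ}
  {d : ν.InputIdx → ℝ} {b : ν.StateIdx → ℝ} {mu : ι → ι → ℝ} {i : ι}

lemma exists_abs_state_le {S : Set (Fin (n i) → ℝ)} (hS : Bornology.IsBounded S) (hi : i ∈ ν.M)
    (a : Fin (n i)) : ∃ R, ∀ x : ν.StateIdx → ℝ, ν.U i *ᵥ x ∈ S → |x ⟨⟨i, hi⟩, a⟩| ≤ R := by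
  simp only [ν.U_mulVec hi]
  exact (exists_abs_apply_le_of_isBounded hS).imp fun _ hR _ hx => hR _ hx a

lemma exists_abs_input_le {S : Set (Fin (m i) → ℝ)} (hS : Bornology.IsBounded S) (hi : i ∈ ν.M)
    (a : Fin (m i)) : ∃ R, ∀ u : ν.InputIdx → ℝ, ν.V i *ᵥ u ∈ S → |u ⟨⟨i, hi⟩, a⟩| ≤ R := by
  simp only [ν.V_mulVec hi]
  exact (exists_abs_apply_le_of_isBounded hS).imp fun _ hR _ hu => hR _ hu a

lemma InvarianceConstraint.U_b_le (h : ν.InvarianceConstraint i α c d b mu) (k : Fin (n i)) :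
    (ν.U i *ᵥ b) k ≤ α i := by
  have hk := Finset.single_le_sum (fun k _ => h.U_b_nonneg k) (Finset.mem_univ k)
  obtain ⟨-, -, -, hsum, hmu⟩ := h
  linarith [Finset.sum_nonneg hmu]

lemma InvarianceConstraint.mu_le (h : ν.InvarianceConstraint i α c d b mu) {j : ι}
    (hj : j ∈ ν.N i) : mu i j ≤ α i := by
  have hb := Finset.sum_nonneg fun k (_ : k ∈ Finset.univ) => h.U_b_nonneg k
  obtain ⟨-, -, -, hsum, hmu⟩ := h
  linarith [Finset.single_le_sum hmu hj, show (0 : ℝ) ≤ _ from hb]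

lemma TerminalParams.center_mem_X (h : ν.TerminalParams α c d b mu) (hi : i ∈ ν.M) :
    ν.U i *ᵥ c ∈ ν.X i :=
  h.mem_X hi <| by
    change quad _ _ ≤ _
    rw [sub_self, quad_zero]
    positivity

lemma exists_forall_terminalParams_size_le (hi : i ∈ ν.M) (hn : 0 < n i)
    (hX : Bornology.IsBounded (ν.X i)) :
    ∃ R, ∀ α c d b mu, ν.TerminalParams α c d b mu → α i ≤ R := by
  have := Fin.pos_iff_nonempty.mp hn
  have hnorm : 0 < ‖(1 : Fin (n i) → ℝ)‖ := norm_pos_iff.mpr one_ne_zero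
  exact ⟨_, fun α c d b mu h => (le_div_iff₀ hnorm).mpr <|
    mul_norm_le_diam_mul_sqrt_quad (ν.P_posDef i hi) hX (h.size i hi)
      (fun _ hx => h.mem_X hi hx) 1⟩

lemma exists_forall_terminalParams_abs_le (hi : i ∈ ν.M) (hn : 0 < n i)
    (hX : Bornology.IsBounded (ν.X i)) :
    ∃ R, ∀ α c d b mu, ν.TerminalParams α c d b mu →
      |α i| ≤ R ∧ (∀ k, |(ν.U i *ᵥ b) k| ≤ R) ∧ ∀ j ∈ ν.N i, |mu i j| ≤ R := by
  refine (exists_forall_terminalParams_size_le hi hn hX).imp fun R hR α c d b mu h => ?_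
  have hα := hR α c d b mu h
  have hinv := h.invariance i hi
  refine ⟨(abs_of_nonneg (h.size i hi)).trans_le hα, fun k => ?_, fun j hj => ?_⟩
  · exact (abs_of_nonneg (hinv.U_b_nonneg k)).trans_le ((hinv.U_b_le k).trans hα)
  · exact (abs_of_nonneg (hinv.2.2.2.2 j hj)).trans_le ((hinv.mu_le hj).trans hα)

variable {Xf : TerminalConstraint} {T : ℕ}

lemma Feasible.V_d_mem {x₀ : ν.StateIdx → ℝ} {z : ν.Plan} (h : ν.Feasible Xf T x₀ z)
    (hi : i ∈ ν.M) : ν.V i *ᵥ z.d ∈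
      ν.lam i • ν.Uset i - (fun x => ν.K i *ᵥ x) '' (ν.lam i • ν.X i) :=
  ⟨_, h.eq_input i hi, _, ⟨_, h.eq_state i hi, rfl⟩, by
    simp only [h.eq_ctrl i hi, add_sub_cancel_left]⟩

lemma exists_forall_feasible_abs_truncate_le (hn : ∀ i ∈ ν.M, 0 < n i)
    (hb : ∀ i ∈ ν.M, Bornology.IsBounded (ν.X i) ∧ Bornology.IsBounded (ν.Uset i))
    (v : ν.PlanVar) : ∃ R, ∀ x₀ z, ν.Feasible Xf T x₀ z → |truncate T z v| ≤ R := by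
  have hparams := fun i hi => exists_forall_terminalParams_abs_le hi (hn i hi) (hb i hi).1
  have hlamX := fun i hi => (hb i hi).1.smul₀ (ν.lam i)
  have hlamU := fun i hi => (hb i hi).2.smul₀ (ν.lam i)
  have hd := fun i hi => (hlamU i hi).sub (isBounded_mulVec_image (ν.K i) (hlamX i hi))
  rcases v with ⟨t, ⟨i, hi⟩, a⟩ | ⟨t, ⟨i, hi⟩, a⟩ | ⟨⟨i, hi⟩, a⟩ | ⟨⟨i, hi⟩, a⟩ | i |
    ⟨⟨i, hi⟩, a⟩ | ⟨⟨i, hi⟩, a⟩ | ⟨⟨i, hi⟩, a⟩ | ⟨i, j⟩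
  case x =>
    by_cases ht : t ≤ T
    · simp only [truncate, if_pos ht]
      exact (exists_abs_state_le (hb i hi).1 hi a).imp fun R hR _ z h => hR _ (h.state t ht i hi)
    · exact ⟨0, by simp [truncate, ht]⟩
  case u =>
    by_cases ht : t < T
    · simp only [truncate, if_pos ht]
      exact (exists_abs_input_le (hb i hi).2 hi a).imp fun R hR _ z h => hR _ (h.input t ht i hi)
    · exact ⟨0, by simp [truncate, ht]⟩
  case xe =>
    exact (exists_abs_state_le (hlamX i hi) hi a).imp fun R hR _ z h => hR _ (h.eq_state i hi)
  case ue =>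
    exact (exists_abs_input_le (hlamU i hi) hi a).imp fun R hR _ z h => hR _ (h.eq_input i hi)
  case α =>
    by_cases hi : i ∈ ν.M
    · simp only [truncate, if_pos hi]
      exact (hparams i hi).imp fun R hR _ z h => (hR _ _ _ _ _ h.terminalParams).1
    · exact ⟨0, by simp [truncate, hi]⟩
  case c =>
    exact (exists_abs_state_le (hb i hi).1 hi a).imp fun R hR _ z h =>
      hR _ (h.terminalParams.center_mem_X hi)
  case d => exact (exists_abs_input_le (hd i hi) hi a).imp fun R hR _ z h => hR _ (h.V_d_mem hi)
  case b =>
    refine (hparams i hi).imp fun R hR _ z h => ?_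
    simpa only [truncate, ν.U_mulVec hi] using (hR _ _ _ _ _ h.terminalParams).2.1 a
  case mu =>
    by_cases hij : i ∈ ν.M ∧ j ∈ ν.N i
    · simp only [truncate, if_pos hij]
      exact (hparams i hij.1).imp fun R hR _ z h => (hR _ _ _ _ _ h.terminalParams).2.2 j hij.2
    · exact ⟨0, by simp [truncate, hij]⟩

lemma exists_optimal (hn : ∀ i ∈ ν.M, 0 < n i) (hXf : Xf.Closed)
    (hb : ∀ i ∈ ν.M, Bornology.IsBounded (ν.X i) ∧ Bornology.IsBounded (ν.Uset i))
    (xr : ν.StateIdx → ℝ) {x₀ : ν.StateIdx → ℝ} (hx₀ : x₀ ∈ ν.feasibleStates Xf T) :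
    ∃ z, ν.Optimal Xf T xr x₀ z := by
  choose R hR using exists_forall_feasible_abs_truncate_le (Xf := Xf) (T := T) hn hb
  have hS := isCompact_inter_forall_abs_le (isClosed_feasible_toPlan hXf T x₀) R
  have hmem : ∀ z, ν.Feasible Xf T x₀ z → truncate T z ∈
      {y | ν.Feasible Xf T x₀ (toPlan y)} ∩ {y | ∀ v, |y v| ≤ R v} := fun z hz =>
    ⟨hz.toPlan_truncate, fun v => hR v x₀ z hz⟩
  obtain ⟨z₀, hz₀⟩ := hx₀
  obtain ⟨y, hy, hmin⟩ :=
    hS.exists_isMinOn ⟨_, hmem z₀ hz₀⟩ (continuous_cost_toPlan T xr).continuousOn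
  exact ⟨toPlan y, hy.1, fun z hz => (hmin (hmem z hz)).trans_eq (cost_truncate xr z)⟩

end Bounds

end Network

namespace Network

variable {ι : Type*} [DecidableEq ι]

section AsymptoticStability

variable {n m q r : ι → ℕ} {p : ℕ} {ν : Network ι n m q r p} {Xf : TerminalConstraint} {T : ℕ}
  {xr : ν.StateIdx → ℝ} {ur : ν.InputIdx → ℝ} {δ : ℝ} {α : ι → ℝ} {mu : ι → ι → ℝ}

lemma UniformTerminalSets.locallyTrackable (h : ν.UniformTerminalSets δ α mu)
    (hlmi : ∀ i ∈ ν.M, ν.LocalLMI i) (hT : 1 ≤ T) (xr : ν.StateIdx → ℝ) :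
    ν.LocallyTrackable dominated T xr δ := fun xe ue hadm x hx =>
  ⟨ν.terminalPlan α mu x xe ue, h.feasible_terminalPlan hlmi hT hadm hx,
    cost_terminalPlan_le hlmi xr⟩

/-- The states from which the optimal control problem can be solved with cost at most `δ`. -/
def costSublevel (ν : Network ι n m q r p) (Xf : TerminalConstraint) (T : ℕ)
    (xr : ν.StateIdx → ℝ) (δ : ℝ) : Set (ν.StateIdx → ℝ) :=
  {x | ∃ z, ν.Feasible Xf T x z ∧ ν.cost T xr z ≤ δ}

lemma costSublevel_subset_feasibleStates :
    ν.costSublevel Xf T xr δ ⊆ ν.feasibleStates Xf T := fun _ ⟨z, hz, _⟩ => ⟨z, hz⟩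

lemma LocallyTrackable.costSublevel_mem_nhds (h : ν.LocallyTrackable Xf T xr δ) (hδ : 0 < δ)
    (htarget : ν.AdmissibleTarget xr ur) : ν.costSublevel Xf T xr δ ∈ 𝓝 xr := by
  filter_upwards [eventually_quad_sub_le hδ] with x hx
  obtain ⟨z, hz, hcost⟩ := h xr ur htarget x hx
  rw [sub_self, quad_zero, add_zero] at hcost
  exact ⟨z, hz, hcost.trans hx⟩

lemma costDecreasesOn_feasibleStates_ellipsoid (hlmi : ∀ i ∈ ν.M, ν.LocalLMI i) (hT : 1 ≤ T)
    (xr : ν.StateIdx → ℝ) :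
    ν.CostDecreasesOn ellipsoid T xr (ν.feasibleStates ellipsoid T) := fun _ _ z hz => by
  have hshift := feasible_shiftPlan hz.1 hT fun i hi => hz.1.terminal_succ_mem_ellipsoid hi
  exact ⟨⟨_, hshift⟩, _, hshift, cost_shiftPlan_add_le hz.1 hT hlmi xr⟩

lemma UniformTerminalSets.feasible_recenter (h : ν.UniformTerminalSets δ α mu)
    {x : ν.StateIdx → ℝ} {z : ν.Plan} (hz : ν.Feasible Xf T x z)
    (hterm : quad (ν.diag ν.P) (z.x T - z.xe) ≤ δ) :
    ν.Feasible ellipsoid T x { z with α := α, c := z.xe, b := 0, mu := mu } := by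
  have hp := h.params z.xe z.ue hz.admissibleTarget
  rw [hz.ue_eq, add_sub_cancel_left] at hp
  exact
  { hz with
    size := hp.size
    terminal := fun i hi => by
      change quad _ _ ≤ _
      rw [← Matrix.mulVec_sub]
      exact h.mem_ellipsoid _ hterm i hi
    invariance := hp.invariance
    term_state := hp.term_state
    term_input := hp.term_input }

-- The shift of an optimal plan may violate the polyhedral terminal constraint, but its terminal
-- sets can be replaced by those centred at the artificial equilibrium at no cost.
lemma UniformTerminalSets.costDecreasesOn_costSublevel (h : ν.UniformTerminalSets δ α mu)
    (hlmi : ∀ i ∈ ν.M, ν.LocalLMI i) (hT : 1 ≤ T) (xr : ν.StateIdx → ℝ) :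
    ν.CostDecreasesOn dominated T xr (ν.costSublevel dominated T xr δ) := by
  rintro x ⟨z₁, hz₁, hcost₁⟩ z hz
  have hcost : ν.cost T xr z ≤ δ := (hz.2 z₁ hz₁).trans hcost₁
  have hterm : quad (ν.diag ν.P) (z.x T - z.xe) ≤ δ := (ν.quad_terminal_le_cost xr z).trans hcost
  have hrecenter := h.feasible_recenter hz.1 hterm
  have hshift := feasible_shiftPlan (Xf := dominated) hrecenter hT fun i hi => by
    rw [mem_dominated_iff_sub_mem, Matrix.mulVec_add, add_sub_cancel_left]
    exact h.bigAcl_mem_dominated _ hterm i hi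
  have hdec := cost_shiftPlan_add_le hrecenter hT hlmi xr
  have hQ := quad_nonneg ν.posDef_diag_Q (x - z.xe)
  exact ⟨⟨_, hshift, (le_of_add_le_of_nonneg_left hdec hQ).trans hcost⟩, _, hshift, hdec⟩

lemma asymptoticallyStable_ellipsoid (hn : ∀ i ∈ ν.M, 0 < n i)
    (hlmi : ∀ i ∈ ν.M, ν.LocalLMI i) (hT : 1 ≤ T)
    (hX : ∀ i ∈ ν.M, (0 : Fin (n i) → ℝ) ∈ interior (ν.X i))
    (hU : ∀ i ∈ ν.M, (0 : Fin (m i) → ℝ) ∈ interior (ν.Uset i))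
    (hterm : ν.NondegenerateTerminalSets) (htarget : ν.AdmissibleTarget xr ur) :
    ν.AsymptoticallyStable ellipsoid T xr (ν.feasibleStates ellipsoid T) := by
  obtain ⟨δ, hδ, α, mu, hunif⟩ := exists_uniformTerminalSets hX hU hterm
  have htrack : ν.LocallyTrackable ellipsoid T xr δ :=
    (hunif.locallyTrackable hlmi hT xr).mono fun _ _ h => h.of_dominated
  exact (costDecreasesOn_feasibleStates_ellipsoid hlmi hT xr).asymptoticallyStable hT htarget
    htrack hδ (mem_of_superset (htrack.costSublevel_mem_nhds hδ htarget)
      costSublevel_subset_feasibleStates)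
    subset_rfl fun hb _ hx => exists_optimal hn closed_ellipsoid hb xr hx

lemma exists_asymptoticallyStable_dominated (hn : ∀ i ∈ ν.M, 0 < n i)
    (hlmi : ∀ i ∈ ν.M, ν.LocalLMI i) (hT : 1 ≤ T)
    (hX : ∀ i ∈ ν.M, (0 : Fin (n i) → ℝ) ∈ interior (ν.X i))
    (hU : ∀ i ∈ ν.M, (0 : Fin (m i) → ℝ) ∈ interior (ν.Uset i))
    (hterm : ν.NondegenerateTerminalSets) (htarget : ν.AdmissibleTarget xr ur) :
    ∃ E, ν.AsymptoticallyStable dominated T xr E := by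
  obtain ⟨δ, hδ, α, mu, hunif⟩ := exists_uniformTerminalSets hX hU hterm
  have htrack := hunif.locallyTrackable hlmi hT xr
  exact ⟨ν.costSublevel dominated T xr δ,
    (hunif.costDecreasesOn_costSublevel hlmi hT xr).asymptoticallyStable hT htarget htrack hδ
      (htrack.costSublevel_mem_nhds hδ htarget) costSublevel_subset_feasibleStates
      fun hb _ hx => exists_optimal hn closed_dominated hb xr
        (costSublevel_subset_feasibleStates hx)⟩

end AsymptoticStability

end Network

theorem theorem2_general {ι : Type*} [DecidableEq ι] {n m q r : ι → ℕ} {p : ℕ} (k : ℕ)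
    (net : ℕ → Network ι n m q r p) (hn : ∀ i ∈ (net k).M, 0 < n i)
    (hinit : ∀ i ∈ (net 0).M, (net 0).LocalLMI i)
    (hreq : ∀ s < k, Network.PnPRequest (net s) (net (s + 1)))
    (hlmi : ∀ s < k, ∀ i ∈ Network.redesignSet (net s) (net (s + 1)), (net (s + 1)).LocalLMI i)
    (T : ℕ) (hT : 1 ≤ T)
    (hX : ∀ i ∈ (net k).M, (0 : Fin (n i) → ℝ) ∈ interior ((net k).X i))
    (hU : ∀ i ∈ (net k).M, (0 : Fin (m i) → ℝ) ∈ interior ((net k).Uset i))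
    (hterm : (net k).NondegenerateTerminalSets)
    (xr : (net k).StateIdx → ℝ) (ur : (net k).InputIdx → ℝ)
    (htarget : (net k).AdmissibleTarget xr ur) :
    (net k).AsymptoticallyStable Network.ellipsoid T xr
        ((net k).feasibleStates Network.ellipsoid T) ∧
      ∃ E, (net k).AsymptoticallyStable Network.dominated T xr E := by
  have hlmi_final := Network.localLMI_of_requests hinit hreq hlmi
  exact ⟨Network.asymptoticallyStable_ellipsoid hn hlmi_final hT hX hU hterm htarget,
    Network.exists_asymptoticallyStable_dominated hn hlmi_final hT hX hU hterm htarget⟩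

theorem theorem2 {ι : Type*} [DecidableEq ι] {n m q r : ι → ℕ} {p : ℕ} (hn : ∀ i, 0 < n i)
    -- the networks before any request and after the first, the second, … request
    (k : ℕ) (net : ℕ → Network ι n m q r p)
    (hinit : (net 0).InitialAssumption)
    (hreq : ∀ s < k, Network.PnPRequest (net s) (net (s + 1)))
    -- after each request, the joining and affected subsystems and their neighbours are redesigned
    (hlmi : ∀ s < k, ∀ i ∈ Network.redesignSet (net s) (net (s + 1)), (net (s + 1)).LocalLMI i)
    -- the controller of the `k`-th network
    (T : ℕ) (hT : 1 ≤ T)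
    (hX : ∀ i ∈ (net k).M, (0 : Fin (n i) → ℝ) ∈ interior ((net k).X i))
    (hU : ∀ i ∈ (net k).M, (0 : Fin (m i) → ℝ) ∈ interior ((net k).Uset i))
    (hterm : (net k).NondegenerateTerminalSets)
    (xr : (net k).StateIdx → ℝ) (ur : (net k).InputIdx → ℝ)
    (htarget : (net k).AdmissibleTarget xr ur) :
    -- terminal sets are ellipsoids: stability on the whole feasible set
    (net k).AsymptoticallyStable Network.ellipsoid T xr
        ((net k).feasibleStates Network.ellipsoid T) ∧
    -- terminal sets are the polyhedral inner approximations: stability on a neighbourhood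
    ∃ E, (net k).AsymptoticallyStable Network.dominated T xr E := by
  obtain ⟨Γ, D, ε, hinit⟩ := hinit
  exact theorem2_general k net (fun i _ => hn i)
    (fun i hi => (hinit ⟨i, hi⟩).2.2.2.2.2.2.2.2) hreq hlmi T hT hX hU hterm xr ur htarget
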